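/- Let $n\ge 2$, let $B_n$ be the braid group on $n$ strands with Artin generators $\sigma_1,\dots,\sigma_{n-1}$, and let $\rho\colon B_n\to \mathrm{GL}_n(\mathbb Z)$ be the integral Burau representation: $\rho(\sigma_i)$ is the identity matrix except for the block $\begin{pmatrix}2&-1\\1&0\end{pmatrix}$ in the rows and columns $i,i+1$. Let $\langle\cdot,\cdot\rangle$ be the alternating form on $\mathbb Z^n$ with $\langle e_i,e_j\rangle=(-1)^{i+j+1}$ for $i<j$, put $v_n=\sum_i e_i$ and $w_n=\sum_i(-1)^{i-1}e_i$, and let $$\Gamma_{n-1}=\{A\in \mathrm{GL}_n(\mathbb Z) : \langle Av,Aw\rangle=\langle v,w\rangle \text{ for all } v,w\in\mathbb Z^n,\ Av_n=v_n,\ w_n^TA=w_n^T\},$$ which contains $\rho(B_n)$. For $\ell\in\mathbb Z$ let $\Gamma_{n-1}[\ell]=\{A\in\Gamma_{n-1}: A\equiv I \bmod \ell\}$ and $B_n[\ell]=\{b\in B_n:\rho(b)\equiv I\bmod \ell\}$. There is an isomorphism from $\Gamma_{n-1}$ onto $\mathrm{Sp}_{n-1}(\mathbb Z)$ if $n$ is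 odd, and onto the stabilizer $[\mathrm{Sp}_{n}(\mathbb Z)]_{e_1}$ of the first standard basis vector if $n$ is even, which for every $d \in \mathbb Z$ identifies $\Gamma_{n-1}[d]$ with the subgroup of matrices congruent to $I$ modulo $d$. Let $\ell=2^km$ with $k\ge 0$ and $m$ odd. (1) If $n=2$ or $n=3$, then $\rho$ induces an isomorphism $B_n/B_n[\ell]\cong\Gamma_{n-1}/\Gamma_{n-1}[\ell]$. (2) If $n\ge 4$, then the quotient map and $\rho$ induce an isomorphism $B_n/B_n[\ell]\cong B_n/B_n[2^k]\times\Gamma_{n-1}/\Gamma_{n-1}[m]$. Moreover, the image of $B_n$ in $\Gamma_{n-1}/\Gamma_{n-1}[2]$ is isomorphic to the symmetric group $S_n$, the class of $\rho(\sigma_i)$ corresponding to the transposition $(i\ i{+}1)$; write $S_n\le\Gamma_{n-1}/\Gamma_{n-1}[2]$ for it. Then: - if $k=0$, the group $B_n/B_n[2^k]$ is trivial; - if $k=1$, there is an isomorphism $B_n/B_n[2^k]\cong S_n$ with $\sigma_i\mapsto(i\ i{+}1)$; - if $k\ge 2$, then $\rho$ induces an isomorphism of $B_n/B_n[2^k]$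 onto the preimage $X$ of $S_n$ under the quotient map $\Gamma_{n-1}/\Gamma_{n-1}[2^k]\to\Gamma_{n-1}/\Gamma_{n-1}[2]$, and the sequence $1\to\Gamma_{n-1}[2]/\Gamma_{n-1}[2^k]\to X\to S_n\to 1$ of the inclusion and the quotient map is exact and does not split. -/

import Mathlib

namespace BraidCongruence

/-! ### The braid group -/

/-- The Artin relators on the generators `σ_0, …, σ_{n-2}`:
`σ_i σ_{i+1} σ_i = σ_{i+1} σ_i σ_{i+1}`, and `σ_i σ_j = σ_j σ_i` whenever `i + 2 ≤ j`. -/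
def artinRelators (n : ℕ) : Set (FreeGroup (Fin (n - 1))) :=
  {r | ∃ i j : Fin (n - 1), (i : ℕ) + 1 = j ∧
      r = (FreeGroup.of i * FreeGroup.of j * FreeGroup.of i) *
        (FreeGroup.of j * FreeGroup.of i * FreeGroup.of j)⁻¹} ∪
  {r | ∃ i j : Fin (n - 1), (i : ℕ) + 2 ≤ j ∧
      r = (FreeGroup.of i * FreeGroup.of j) * (FreeGroup.of j * FreeGroup.of i)⁻¹}

/-- The braid group `B_n` on `n` strands, in its Artin presentation. -/
abbrev Braid (n : ℕ) : Type := PresentedGroup (artinRelators n)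

/-- The Artin generator `σ_i` (indices start at `0`): the half twist on the strands `i`, `i + 1`. -/
def sigma {n : ℕ} (i : Fin (n - 1)) : Braid n := PresentedGroup.of i

/-- The strand `i`, for the index `i` of an Artin generator. -/
def lo {n : ℕ} (i : Fin (n - 1)) : Fin n := ⟨i, by omega⟩

/-- The strand `i + 1`, for the index `i` of an Artin generator. -/
def hi {n : ℕ} (i : Fin (n - 1)) : Fin n := ⟨i + 1, by omega⟩

/-! ### The group of isometries that contains the image of the Burau representation -/

/-- The Gram matrix of the alternating form on `ℤⁿ` with
`⟨e_a, e_b⟩ = (-1)^(a+b+1)` for `a < b`, `0` for `a = b`, and `(-1)^(a+b)` for `a > b`. -/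
def gram (n : ℕ) : Matrix (Fin n) (Fin n) ℤ :=
  Matrix.of fun a b =>
    if a < b then (-1) ^ ((a : ℕ) + b + 1) else if a = b then 0 else (-1) ^ ((a : ℕ) + b)

/-- The alternating form on `ℤⁿ`. -/
def form {n : ℕ} (v w : Fin n → ℤ) : ℤ := v ⬝ᵥ (Matrix.mulVec (gram n) w)

/-- `v_n = e_1 + e_2 + ⋯ + e_n`. -/
def vVec (n : ℕ) : Fin n → ℤ := fun _ => 1

/-- `w_n = e_1 - e_2 + ⋯ + (-1)^(n-1) e_n`. -/
def wVec (n : ℕ) : Fin n → ℤ := fun a => (-1) ^ (a : ℕ)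

/-- For `n ≥ 1`, the group `Γ_{n-1}` (indexed here by the size `n` of its matrices): the `A` in
`GL_n(ℤ)` that preserve the form and satisfy `A v_n = v_n` and `w_nᵀ A = w_nᵀ`. -/
def Gam (n : ℕ) : Subgroup (GL (Fin n) ℤ) where
  carrier := {A | (∀ v w : Fin n → ℤ, form (A.1.mulVec v) (A.1.mulVec w) = form v w) ∧
    A.1.mulVec (vVec n) = vVec n ∧ Matrix.vecMul (wVec n) A.1 = wVec n}
  mul_mem' := by
    rintro A B ⟨hA, hA', hA''⟩ ⟨hB, hB', hB''⟩
    refine ⟨fun v w => ?_, ?_, ?_⟩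
    · rw [Units.val_mul, ← Matrix.mulVec_mulVec, ← Matrix.mulVec_mulVec, hA, hB]
    · rw [Units.val_mul, ← Matrix.mulVec_mulVec, hB', hA']
    · rw [Units.val_mul, ← Matrix.vecMul_vecMul, hA'', hB'']
  one_mem' := by simp
  inv_mem' := by
    rintro A ⟨hA, hA', hA''⟩
    have h1 : A.1 * (A⁻¹).1 = 1 := by rw [← Units.val_mul, mul_inv_cancel, Units.val_one]
    have h2 : (A⁻¹).1 * A.1 = 1 := by rw [← Units.val_mul, inv_mul_cancel, Units.val_one]
    refine ⟨fun v w => ?_, ?_, ?_⟩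
    · rw [← hA, Matrix.mulVec_mulVec, Matrix.mulVec_mulVec, h1, Matrix.one_mulVec,
        Matrix.one_mulVec]
    · conv_lhs => rw [← hA']
      rw [Matrix.mulVec_mulVec, h2, Matrix.one_mulVec]
    · conv_lhs => rw [← hA'']
      rw [Matrix.vecMul_vecMul, h1, Matrix.vecMul_one]

/-- Reduction modulo `ℓ`, `GL_n(ℤ) → GL_n(ℤ/ℓℤ)`. -/
def reduceGL (n : ℕ) (ℓ : ℤ) : GL (Fin n) ℤ →* GL (Fin n) (ℤ ⧸ Ideal.span {ℓ}) :=
  Matrix.GeneralLinearGroup.map (Ideal.Quotient.mk (Ideal.span {ℓ}))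

/-- The level `ℓ` congruence subgroup `Γ_{n-1}[ℓ]` of `Γ_{n-1}`. -/
def GamLevel (n : ℕ) (ℓ : ℤ) : Subgroup (Gam n) := ((reduceGL n ℓ).comp (Gam n).subtype).ker

instance (n : ℕ) (ℓ : ℤ) : (GamLevel n ℓ).Normal := MonoidHom.normal_ker _

theorem mem_GamLevel {n : ℕ} {ℓ : ℤ} {A : Gam n} :
    A ∈ GamLevel n ℓ ↔ ∀ a b, ℓ ∣ A.1.1 a b - (1 : Matrix (Fin n) (Fin n) ℤ) a b := by
  rw [GamLevel, MonoidHom.mem_ker, Matrix.GeneralLinearGroup.ext_iff]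
  refine forall_congr' fun a => forall_congr' fun b => ?_
  rw [← Ideal.mem_span_singleton, ← Ideal.Quotient.eq]
  have h : (Ideal.Quotient.mk (Ideal.span {ℓ})) ((1 : Matrix (Fin n) (Fin n) ℤ) a b) =
      (1 : Matrix (Fin n) (Fin n) (ℤ ⧸ Ideal.span {ℓ})) a b := by
    by_cases hab : a = b <;> simp [Matrix.one_apply, hab]
  rw [h]
  rfl

theorem GamLevel_le (n : ℕ) {d ℓ : ℤ} (h : d ∣ ℓ) : GamLevel n ℓ ≤ GamLevel n d := fun _ hA =>
  mem_GamLevel.2 fun a b => h.trans (mem_GamLevel.1 hA a b)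

/-- The quotient map `Γ_{n-1}/Γ_{n-1}[ℓ] → Γ_{n-1}/Γ_{n-1}[d]`, for `d ∣ ℓ`. -/
def GamProj (n : ℕ) {d ℓ : ℤ} (h : d ∣ ℓ) : Gam n ⧸ GamLevel n ℓ →* Gam n ⧸ GamLevel n d :=
  QuotientGroup.map _ _ (MonoidHom.id _) (GamLevel_le n h)

/-! ### The integral Burau representation -/

/-- The matrix of `σ_i`: the identity, but for the block `!![2, -1; 1, 0]` in the rows and columns
`i`, `i + 1`. -/
def burauMatrix {n : ℕ} (i : Fin (n - 1)) : Matrix (Fin n) (Fin n) ℤ :=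
  Matrix.of fun a b =>
    if a = lo i then (if b = lo i then 2 else if b = hi i then -1 else 0)
    else if a = hi i then (if b = lo i then 1 else 0)
    else if a = b then 1 else 0

/-- The column `e_i + e_{i+1}`. -/
def colVec {n : ℕ} (i : Fin (n - 1)) : Fin n → ℤ := Pi.single (lo i) 1 + Pi.single (hi i) 1

/-- The row `e_i - e_{i+1}`. -/
def rowVec {n : ℕ} (i : Fin (n - 1)) : Fin n → ℤ := Pi.single (lo i) 1 - Pi.single (hi i) 1

theorem burauMatrix_eq {n : ℕ} (i : Fin (n - 1)) :
    burauMatrix i = 1 + Matrix.vecMulVec (colVec i) (rowVec i) := by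
  have hne : lo i ≠ hi i := by simp [lo, hi]
  ext a b
  simp only [burauMatrix, colVec, rowVec, Matrix.of_apply, Matrix.add_apply, Matrix.one_apply,
    Matrix.vecMulVec_apply, Pi.add_apply, Pi.sub_apply, Pi.single_apply]
  split_ifs <;> simp_all

theorem row_dot_col {n : ℕ} (i j : Fin (n - 1)) :
    rowVec i ⬝ᵥ colVec j =
      if (i : ℕ) + 1 = j then -1 else if (j : ℕ) + 1 = i then 1 else 0 := by
  simp only [rowVec, colVec, sub_dotProduct, dotProduct_add, single_dotProduct, Pi.single_apply,
    lo, hi, Fin.mk.injEq]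
  split_ifs <;> omega

theorem nil_mul_nil {n : ℕ} (i j : Fin (n - 1)) :
    Matrix.vecMulVec (colVec i) (rowVec i) * Matrix.vecMulVec (colVec j) (rowVec j) =
      (rowVec i ⬝ᵥ colVec j) • Matrix.vecMulVec (colVec i) (rowVec j) := by
  rw [Matrix.vecMulVec_mul_vecMulVec, Matrix.vecMulVec_smul]

theorem nil_sq {n : ℕ} (i : Fin (n - 1)) :
    Matrix.vecMulVec (colVec i) (rowVec i) * Matrix.vecMulVec (colVec i) (rowVec i) = 0 := by
  rw [nil_mul_nil, row_dot_col]
  simp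

/-- The matrix of `σ_i` as an element of `GL_n(ℤ)`. -/
def burauGL {n : ℕ} (i : Fin (n - 1)) : GL (Fin n) ℤ where
  val := burauMatrix i
  inv := 2 - burauMatrix i
  val_inv := by
    rw [burauMatrix_eq]
    have h := nil_sq i
    set N := Matrix.vecMulVec (colVec i) (rowVec i)
    calc (1 + N) * (2 - (1 + N)) = 1 - N * N := by noncomm_ring
      _ = 1 := by rw [h, sub_zero]
  inv_val := by
    rw [burauMatrix_eq]
    have h := nil_sq i
    set N := Matrix.vecMulVec (colVec i) (rowVec i)
    calc (2 - (1 + N)) * (1 + N) = 1 - N * N := by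
          rw [← one_add_one_eq_two]; noncomm_ring
      _ = 1 := by rw [h, sub_zero]

theorem gram_mulVec_col {n : ℕ} (i : Fin (n - 1)) :
    (gram n).mulVec (colVec i) = rowVec i := by
  have hi' : ((lo i : Fin n) : ℕ) = i := rfl
  have hi'' : ((hi i : Fin n) : ℕ) = i + 1 := rfl
  ext a
  simp only [colVec, Matrix.mulVec_add, Pi.add_apply, Matrix.mulVec_single_one, Matrix.col_apply,
    rowVec, Pi.sub_apply, Pi.single_apply, gram, Matrix.of_apply, Fin.lt_def, Fin.ext_iff, hi', hi'']
  rcases lt_trichotomy (a : ℕ) i with h | h | h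
  · simp [h, h.ne, show (a : ℕ) < i + 1 by omega, show (a : ℕ) ≠ i + 1 by omega]
    ring
  · have : (-1 : ℤ) ^ ((i : ℕ) + (i + 1) + 1) = 1 := Even.neg_one_pow ⟨i + 1, by ring⟩
    simp [h, this]
  · rcases eq_or_ne (a : ℕ) (i + 1) with h' | h'
    · have : (-1 : ℤ) ^ ((i : ℕ) + 1 + i) = -1 := Odd.neg_one_pow ⟨i, by ring⟩
      simp [h', this]
    · simp [h.not_gt, h.ne', show ¬ (a : ℕ) < i + 1 by omega, h']
      ring

theorem form_antisymm {n : ℕ} (v w : Fin n → ℤ) : form v w = - form w v := by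
  have h : (gram n).transpose = - gram n := by
    ext a b
    simp only [gram, Matrix.transpose_apply, Matrix.of_apply, Matrix.neg_apply, add_comm (b : ℕ) a,
      pow_succ]
    rcases lt_trichotomy a b with h | h | h
    · simp [h, h.not_gt, h.ne']
    · simp [h]
    · simp [h, h.not_gt, h.ne']
  rw [form, form, Matrix.dotProduct_mulVec, ← Matrix.mulVec_transpose, h, Matrix.neg_mulVec,
    neg_dotProduct, dotProduct_comm]

theorem burauGL_mem {n : ℕ} (i : Fin (n - 1)) : burauGL i ∈ Gam n := by
  have hmv : ∀ v, (burauMatrix i).mulVec v = v + (rowVec i ⬝ᵥ v) • colVec i := by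
    intro v
    rw [burauMatrix_eq, Matrix.add_mulVec, Matrix.one_mulVec, Matrix.vecMulVec_mulVec]
    simp [op_smul_eq_smul]
  have hf : ∀ v, form v (colVec i) = rowVec i ⬝ᵥ v := by
    intro v
    rw [form, gram_mulVec_col, dotProduct_comm]
  have hf' : ∀ v, form (colVec i) v = - (rowVec i ⬝ᵥ v) := by
    intro v
    rw [form_antisymm, hf]
  refine ⟨fun v w => ?_, ?_, ?_⟩
  · change form ((burauMatrix i).mulVec v) ((burauMatrix i).mulVec w) = form v w
    rw [hmv, hmv]
    have hz : rowVec i ⬝ᵥ colVec i = 0 := by simp [row_dot_col]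
    have hl : ∀ (a b c : Fin n → ℤ) (s : ℤ), form (a + s • b) c = form a c + s * form b c := by
      intro a b c s
      rw [form, add_dotProduct, smul_dotProduct, smul_eq_mul, form, form]
    have hr : ∀ (a b c : Fin n → ℤ) (s : ℤ), form a (b + s • c) = form a b + s * form a c := by
      intro a b c s
      rw [form, Matrix.mulVec_add, Matrix.mulVec_smul, dotProduct_add, dotProduct_smul, smul_eq_mul,
        form, form]
    rw [hl, hr, hr, hf, hf, hf', hz]
    ring
  · change (burauMatrix i).mulVec (vVec n) = vVec n
    rw [hmv]
    have : rowVec i ⬝ᵥ vVec n = 0 := by simp [rowVec, vVec, sub_dotProduct]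
    rw [this, zero_smul, add_zero]
  · change Matrix.vecMul (wVec n) (burauMatrix i) = wVec n
    rw [burauMatrix_eq, Matrix.vecMul_add, Matrix.vecMul_one, Matrix.vecMul_vecMulVec]
    have : wVec n ⬝ᵥ colVec i = 0 := by
      simp [colVec, wVec, dotProduct_add, lo, hi, pow_succ]
    rw [this, zero_smul, add_zero]

/-- The matrix of `σ_i` as an element of `Γ_{n-1}`. -/
def burauGen {n : ℕ} (i : Fin (n - 1)) : Gam n := ⟨burauGL i, burauGL_mem i⟩

theorem burauGen_relators {n : ℕ} : ∀ r ∈ artinRelators n, FreeGroup.lift burauGen r = 1 := by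
  have hval : ∀ i : Fin (n - 1), (burauGen i).1.1 =
      1 + Matrix.vecMulVec (colVec i) (rowVec i) := burauMatrix_eq
  rintro r (⟨i, j, hij, rfl⟩ | ⟨i, j, hij, rfl⟩)
  · simp only [map_mul, map_inv, FreeGroup.lift_apply_of]
    rw [mul_inv_eq_one]
    refine Subtype.ext (Units.ext ?_)
    simp only [Subgroup.coe_mul, Units.val_mul, hval]
    have hii := nil_sq i
    have hjj := nil_sq j
    have h1 : rowVec i ⬝ᵥ colVec j = -1 := by rw [row_dot_col, if_pos hij]
    have h2 : rowVec j ⬝ᵥ colVec i = 1 := by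
      rw [row_dot_col, if_neg (by omega), if_pos hij]
    have e1 : Matrix.vecMulVec (colVec i) (rowVec i) * Matrix.vecMulVec (colVec j) (rowVec j) *
        Matrix.vecMulVec (colVec i) (rowVec i) = - Matrix.vecMulVec (colVec i) (rowVec i) := by
      rw [nil_mul_nil, h1, Matrix.smul_mul, Matrix.vecMulVec_mul_vecMulVec, h2]
      simp
    have e2 : Matrix.vecMulVec (colVec j) (rowVec j) * Matrix.vecMulVec (colVec i) (rowVec i) *
        Matrix.vecMulVec (colVec j) (rowVec j) = - Matrix.vecMulVec (colVec j) (rowVec j) := by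
      rw [nil_mul_nil, h2, Matrix.smul_mul, Matrix.vecMulVec_mul_vecMulVec, h1]
      simp
    set N := Matrix.vecMulVec (colVec i) (rowVec i)
    set M := Matrix.vecMulVec (colVec j) (rowVec j)
    calc (1 + N) * (1 + M) * (1 + N) = 1 + 2 * N + M + N * M + M * N + N * N + N * M * N := by
          noncomm_ring
      _ = 1 + 2 * M + N + M * N + N * M + M * M + M * N * M := by
          rw [hii, hjj, e1, e2]; noncomm_ring
      _ = (1 + M) * (1 + N) * (1 + M) := by noncomm_ring
  · simp only [map_mul, map_inv, FreeGroup.lift_apply_of]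
    rw [mul_inv_eq_one]
    refine Subtype.ext (Units.ext ?_)
    simp only [Subgroup.coe_mul, Units.val_mul, hval]
    have e1 : Matrix.vecMulVec (colVec i) (rowVec i) * Matrix.vecMulVec (colVec j) (rowVec j) =
        0 := by
      rw [nil_mul_nil, row_dot_col, if_neg (by omega), if_neg (by omega), zero_smul]
    have e2 : Matrix.vecMulVec (colVec j) (rowVec j) * Matrix.vecMulVec (colVec i) (rowVec i) =
        0 := by
      rw [nil_mul_nil, row_dot_col, if_neg (by omega), if_neg (by omega), zero_smul]
    set N := Matrix.vecMulVec (colVec i) (rowVec i)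
    set M := Matrix.vecMulVec (colVec j) (rowVec j)
    calc (1 + N) * (1 + M) = 1 + N + M + N * M := by noncomm_ring
      _ = 1 + N + M + M * N := by rw [e1, e2]
      _ = (1 + M) * (1 + N) := by noncomm_ring

/-- The integral Burau representation `ρ : B_n → Γ_{n-1} ≤ GL_n(ℤ)`. -/
def burau (n : ℕ) : Braid n →* Gam n := PresentedGroup.toGroup burauGen_relators

/-- The level `ℓ` congruence subgroup `B_n[ℓ]`, the kernel of
`B_n → GL_n(ℤ) → GL_n(ℤ/ℓℤ)`. -/
def BraidLevel (n : ℕ) (ℓ : ℤ) : Subgroup (Braid n) :=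
  ((reduceGL n ℓ).comp ((Gam n).subtype.comp (burau n))).ker

instance (n : ℕ) (ℓ : ℤ) : (BraidLevel n ℓ).Normal := MonoidHom.normal_ker _

/-- The image of `B_n` in `Γ_{n-1}/Γ_{n-1}[2]`, which is the copy of the symmetric group `S_n` in
this quotient. -/
def symImage (n : ℕ) : Subgroup (Gam n ⧸ GamLevel n 2) :=
  ((QuotientGroup.mk' (GamLevel n 2)).comp (burau n)).range

theorem two_dvd_two_pow {k : ℕ} (hk : 2 ≤ k) : (2 : ℤ) ∣ 2 ^ k := dvd_pow_self 2 (by omega)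

/-- The preimage of `S_n ≤ Γ_{n-1}/Γ_{n-1}[2]` under the quotient map
`Γ_{n-1}/Γ_{n-1}[ℓ] → Γ_{n-1}/Γ_{n-1}[2]`, for an even `ℓ`. -/
def symPreimage (n : ℕ) {ℓ : ℤ} (h : 2 ∣ ℓ) : Subgroup (Gam n ⧸ GamLevel n ℓ) :=
  (symImage n).comap (GamProj n h)

/-- The quotient `Γ_{n-1}[2]/Γ_{n-1}[ℓ]`, for an even `ℓ`. -/
abbrev LevelQuot (n : ℕ) (ℓ : ℤ) : Type :=
  GamLevel n 2 ⧸ (GamLevel n ℓ).subgroupOf (GamLevel n 2)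

/-! ### Integral symplectic groups -/

/-- `A ≡ I` modulo `ℓ`, entry by entry. -/
def CongrOne {ι : Type} [DecidableEq ι] (ℓ : ℤ) (A : Matrix ι ι ℤ) : Prop :=
  ∀ a b, ℓ ∣ A a b - (1 : Matrix ι ι ℤ) a b

/-- The first standard basis vector `e_1` of `ℤ^(2g+2)`. -/
def e₁ (g : ℕ) : Fin (g + 1) ⊕ Fin (g + 1) → ℤ := Pi.single (Sum.inl 0) 1

/-- The stabilizer `[Sp_{2g+2}(ℤ)]_{e_1}` of `e_1`. -/
def spStab (g : ℕ) : Subgroup (Matrix.symplecticGroup (Fin (g + 1)) ℤ) where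
  carrier := {A | A.1.mulVec (e₁ g) = e₁ g}
  mul_mem' := by
    intro A B (hA : A.1.mulVec (e₁ g) = e₁ g) (hB : B.1.mulVec (e₁ g) = e₁ g)
    change (A.1 * B.1).mulVec (e₁ g) = e₁ g
    rw [← Matrix.mulVec_mulVec, hB, hA]
  one_mem' := Matrix.one_mulVec _
  inv_mem' := by
    intro A (hA : A.1.mulVec (e₁ g) = e₁ g)
    change (A⁻¹).1.mulVec (e₁ g) = e₁ g
    have h : (A⁻¹).1 * A.1 = 1 := congrArg Subtype.val (inv_mul_cancel A)
    conv_lhs => rw [← hA]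
    rw [Matrix.mulVec_mulVec, h, Matrix.one_mulVec]

end BraidCongruence

/-! Everything rests on `σ_i^t` acting as the transvection `1 + t (e_i + e_{i+1})(e_i - e_{i+1})ᵀ`.

For odd `d`, and for every `d` if `n ≤ 3`, `ρ` maps onto `Γ_{n-1}/Γ_{n-1}[d]`. Transvections run
Euclid's algorithm on the adjacent differences of a vector and so carry suitable vectors with unit
alternating sum `s` to `(s, 0, …, 0)` (`reach_single`). Applied to the last column of `A` and to
`e_n`, this makes `A` fix `e_n` up to braids. The form and `w_n` then force `A` to be a block sum
with `1`, and induction on `n` finishes (`exists_burauMod_eq`). The obstruction is that constant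
vectors are fixed by all braids; steering clear of them at odd lengths is what requires `2` to be
invertible once `n ≥ 4`.

For coprime levels, Bézout splits each generator into a product of its powers, which gives a Chinese
remainder theorem for braids.

At powers of `2`, `σ_i` reduces modulo `2` to a permutation matrix. If `1 + 2^j N` lies in `Γ_{n-1}`
with `j ≥ 1`, then `N` modulo `2` is symmetric with vanishing row sums. Such matrices are sums of
matrices `(e_p + e_q)(e_p + e_q)ᵀ`, and these come from conjugates of `σ_i^(2^j)`. Hence braids fill
each quotient `Γ_{n-1}[2^j]/Γ_{n-1}[2^(j+1)]` (`exists_mem_GamLevel_succ`), and the image of `B_n`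
is all of `X`. The extension does not split because no lift of a transposition squares to `1` modulo
`4`.

The symplectic description comes from an explicit basis. For odd `n`, `ℤⁿ` is the sum of the radical
`ℤ v_n` and `w_n^⊥`; for even `n` the form is unimodular, `v_n` is a basis vector, and `w_n` is its
image under the Gram matrix. -/

namespace BraidCongruence
/-! ### Tuples under the Hurwitz action of the braid group -/

section Sequences

variable {R : Type*} [CommRing R]

/-- The effect of the `t`-th power of `σ_i` on a tuple, written as a sequence: the multiple
`t (u_i - u_{i+1})` is added to the entries `i` and `i + 1`. -/
def twist (i : ℕ) (t : R) (u : ℕ → R) : ℕ → R := fun a =>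
  u a + ((if a = i then t * (u i - u (i + 1)) else 0) +
    (if a = i + 1 then t * (u i - u (i + 1)) else 0))

theorem twist_left (i : ℕ) (t : R) (u : ℕ → R) :
    twist i t u i = u i + t * (u i - u (i + 1)) := by
  simp [twist]

theorem twist_right (i : ℕ) (t : R) (u : ℕ → R) :
    twist i t u (i + 1) = u (i + 1) + t * (u i - u (i + 1)) := by
  simp [twist]

theorem twist_other {i a : ℕ} (h : a ≠ i) (h' : a ≠ i + 1) (t : R) (u : ℕ → R) :
    twist i t u a = u a := by
  simp [twist, h, h']

/-- `Reach n u u'`: the sequence `u'` arises from `u` by twists on the first `n` entries. -/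
def Reach (n : ℕ) : (ℕ → R) → (ℕ → R) → Prop :=
  Relation.ReflTransGen fun u u' => ∃ i t, i + 1 < n ∧ u' = twist i t u

theorem reach_twist {n i : ℕ} (h : i + 1 < n) (t : R) (u : ℕ → R) : Reach n u (twist i t u) :=
  Relation.ReflTransGen.single ⟨i, t, h, rfl⟩

theorem Reach.trans {n : ℕ} {u v w : ℕ → R} (h : Reach n u v) (h' : Reach n v w) : Reach n u w :=
  Relation.ReflTransGen.trans h h'

theorem Reach.mono {m n : ℕ} (hmn : m ≤ n) {u v : ℕ → R} (h : Reach m u v) : Reach n u v :=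
  Relation.ReflTransGen.mono (fun _ _ ⟨i, t, hi, e⟩ => ⟨i, t, hi.trans_le hmn, e⟩) _ _ h

theorem Reach.eq_of_le {n a : ℕ} (ha : n ≤ a) {u v : ℕ → R} (h : Reach n u v) : v a = u a := by
  induction h with
  | refl => rfl
  | tail _ hs ih =>
    obtain ⟨i, t, hi, rfl⟩ := hs
    rw [twist_other (by omega) (by omega), ih]

/-- The alternating sum of the first `n` entries. -/
def altSum (n : ℕ) (u : ℕ → R) : R := ∑ a ∈ Finset.range n, (-1) ^ a * u a

theorem altSum_twist {n i : ℕ} (h : i + 1 < n) (t : R) (u : ℕ → R) :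
    altSum n (twist i t u) = altSum n u := by
  simp only [altSum, twist, mul_add, Finset.sum_add_distrib, mul_ite, mul_zero,
    Finset.sum_ite_eq', Finset.mem_range, h, show i < n by omega, if_true, pow_succ]
  ring

theorem Reach.altSum_eq {n : ℕ} {u v : ℕ → R} (h : Reach n u v) : altSum n v = altSum n u := by
  induction h with
  | refl => rfl
  | tail _ hs ih =>
    obtain ⟨i, t, hi, rfl⟩ := hs
    rw [altSum_twist hi, ih]

/-- The differences of the entries `u_j, …, u_{n-1}` generate the unit ideal. -/
def DiffTop (j n : ℕ) (u : ℕ → R) : Prop :=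
  ∀ I : Ideal R, (∀ a, j ≤ a → a < n → u a - u j ∈ I) → I = ⊤

/-- A twist moves every entry by a multiple of `u i - u (i + 1)` and preserves this difference
itself. An ideal with the new differences therefore contains the old ones. -/
theorem DiffTop.twist {j n i : ℕ} (hj : j ≤ i) (hi : i + 1 < n) (t : R) {u : ℕ → R}
    (h : DiffTop j n u) : DiffTop j n (twist i t u) := by
  intro I hI
  refine h I fun a ha ha' => ?_
  have hd : u i - u (i + 1) ∈ I := by
    have := I.sub_mem (hI i hj (by omega)) (hI (i + 1) (by omega) hi)
    rw [twist_left, twist_right] at this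
    convert this using 1
    ring
  have hx : ∀ a, BraidCongruence.twist i t u a - u a ∈ I := by
    intro a
    rw [BraidCongruence.twist, add_sub_cancel_left]
    refine I.add_mem ?_ ?_ <;> split_ifs <;> first | exact I.zero_mem | exact I.mul_mem_left _ hd
  have := I.add_mem (I.sub_mem (hI a ha ha') (hx a)) (hx j)
  convert this using 1
  ring

/-- Euclid's algorithm, as an induction principle on pairs. -/
theorem euclid_induction (hs : Function.Surjective (Int.castRingHom R)) (P : R → R → Prop)
    (h1 : ∀ a b t, P (a + t * b) b → P a b) (h2 : ∀ a b t, P a (b + t * a) → P a b)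
    (h0 : ∀ g, P 0 g) (a b : R) : P a b := by
  have key : ∀ N : ℕ, ∀ x y : ℤ, x.natAbs + y.natAbs ≤ N → P (x : R) (y : R) := by
    intro N
    induction N with
    | zero =>
      intro x y h
      obtain rfl : x = 0 := by omega
      simpa using h0 _
    | succ N ih =>
      intro x y h
      rcases eq_or_ne x 0 with rfl | hx
      · simpa using h0 _
      rcases eq_or_ne y 0 with rfl | hy
      -- The zero has to be in the first place: `(x, 0)` becomes `(x, x)`, then `(0, x)`.
      · refine h2 _ _ 1 (h1 _ _ (-1) ?_)
        simpa using h0 _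
      have h1' : ∀ t : ℤ, (x + t * y).natAbs < x.natAbs → P (x : R) y := by
        intro t ht
        refine h1 _ _ (t : R) ?_
        have := ih (x + t * y) y (by omega)
        push_cast at this
        exact this
      have h2' : ∀ t : ℤ, (y + t * x).natAbs < y.natAbs → P (x : R) y := by
        intro t ht
        refine h2 _ _ (t : R) ?_
        have := ih x (y + t * x) (by omega)
        push_cast at this
        exact this
      rcases le_total x.natAbs y.natAbs with hxy | hxy
      · by_cases hsg : (x + y).natAbs < y.natAbs
        · exact h2' 1 (by omega)
        · exact h2' (-1) (by omega)
      · by_cases hsg : (x + y).natAbs < x.natAbs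
        · exact h1' 1 (by omega)
        · exact h1' (-1) (by omega)
  obtain ⟨x, rfl⟩ := hs a
  obtain ⟨y, rfl⟩ := hs b
  exact key _ x y le_rfl

/-- Write `d_a = u_a - u_{a+1}`. A twist at `j + 1` adds multiples of `d_{j+1}` to `d_j`, and a
twist at `j` adds multiples of `d_j` to `d_{j+1}`, so Euclid's algorithm reaches `d_j = 0`. Then
dropping `u_j` loses no difference, and the induction continues with the tail. When two entries are
left, their difference generates the unit ideal. -/
theorem exists_reach_isUnit (hs : Function.Surjective (Int.castRingHom R)) (k : ℕ) :
    ∀ (j : ℕ) (u : ℕ → R), DiffTop j (j + 2 + k) u →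
      ∃ u', Reach (j + 2 + k) u u' ∧ IsUnit (u' (j + k) - u' (j + k + 1)) := by
  induction k with
  | zero =>
    intro j u h
    refine ⟨u, Relation.ReflTransGen.refl, ?_⟩
    rw [← Ideal.span_singleton_eq_top]
    refine h _ fun a ha ha' => ?_
    rw [Ideal.mem_span_singleton]
    rcases (show a = j ∨ a = j + 1 by omega) with rfl | rfl
    · simp
    · exact ⟨-1, by simp⟩
  | succ k ih =>
    intro j
    suffices H : ∀ a b : R, ∀ u : ℕ → R, u j - u (j + 1) = a → u (j + 1) - u (j + 2) = b →
        DiffTop j (j + 2 + (k + 1)) u → ∃ u', Reach (j + 2 + (k + 1)) u u' ∧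
          IsUnit (u' (j + (k + 1)) - u' (j + (k + 1) + 1)) from fun u => H _ _ u rfl rfl
    refine euclid_induction hs _ ?_ ?_ ?_
    · intro a b t H u ha hb hu
      obtain ⟨u', hr, hu'⟩ := H (twist (j + 1) (-t) u)
        (by rw [twist_other (by omega) (by omega), twist_left, hb, ← ha]; ring)
        (by rw [twist_left, twist_right, ← hb]; ring)
        (hu.twist (by omega) (by omega) _)
      exact ⟨u', (reach_twist (by omega) _ _).trans hr, hu'⟩
    · intro a b t H u ha hb hu
      obtain ⟨u', hr, hu'⟩ := H (twist j t u)
        (by rw [twist_left, twist_right, ← ha]; ring)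
        (by rw [twist_right, twist_other (by omega) (by omega), ha, ← hb]; ring)
        (hu.twist (by omega) (by omega) _)
      exact ⟨u', (reach_twist (by omega) _ _).trans hr, hu'⟩
    · intro g u ha _ hu
      have e : u j = u (j + 1) := sub_eq_zero.1 ha
      have hD : DiffTop (j + 1) (j + 1 + 2 + k) u := by
        intro I hI
        refine hu I fun a ha ha' => ?_
        rcases ha.eq_or_lt with rfl | ha
        · simp
        · rw [e]
          exact hI a ha (by omega)
      obtain ⟨u', hr, hu'⟩ := ih (j + 1) u hD
      exact ⟨u', hr.mono (by omega), by
        rwa [show j + 1 + k = j + (k + 1) by omega] at hu'⟩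

theorem altSum_of_const {n j : ℕ} (hj : j ≤ n) (I : Ideal R) {u : ℕ → R} (c : R)
    (h : ∀ a, a < j → u a - c ∈ I) (h' : ∀ a, j ≤ a → u a = 0) :
    altSum n u - (if Even j then 0 else c) ∈ I := by
  have e : altSum n u = ∑ a ∈ Finset.range j, (-1) ^ a * u a := by
    rw [altSum]
    refine (Finset.sum_subset (Finset.range_mono hj) fun a _ ha => ?_).symm
    rw [h' a (by simpa using ha), mul_zero]
  have e' : (if Even j then 0 else c) = ∑ a ∈ Finset.range j, (-1) ^ a * c := by
    rw [← Finset.sum_mul, neg_one_geom_sum]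
    split_ifs <;> simp
  rw [e, e', ← Finset.sum_sub_distrib]
  refine I.sum_mem fun a ha => ?_
  rw [← mul_sub]
  exact I.mul_mem_left _ (h a (by simpa using ha))

/-- Descent on the index `j` of the last entry that may be nonzero: once the last difference is a
unit, one twist clears the last entry. For an even number of entries `DiffTop` is automatic: if all
entries agree modulo `I`, then the alternating sum `s` lies in `I`. For an odd number greater than
`1` it has to be carried along as a hypothesis. -/
theorem reach_single (hs : Function.Surjective (Int.castRingHom R)) {n : ℕ}
    (h2 : n ≤ 3 ∨ IsUnit (2 : R)) {s : R} (hsu : IsUnit s) (j : ℕ) (hj : j + 1 ≤ n) :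
    ∀ u : ℕ → R, (∀ a, j + 1 ≤ a → u a = 0) → altSum n u = s →
      (Even j → 2 ≤ j → DiffTop 0 (j + 1) u) →
      Reach n u fun a => if a = 0 then s else 0 := by
  induction j with
  | zero =>
    intro u hu hsum _
    have : u = fun a => if a = 0 then s else 0 := by
      ext a
      rcases Nat.eq_zero_or_pos a with rfl | ha
      · have := altSum_of_const hj ⊥ (u := u) (u 0) (fun a ha => by
          obtain rfl : a = 0 := by omega
          simp) hu
        simp only [zero_add, Nat.not_even_one, if_false, Ideal.mem_bot, sub_eq_zero, hsum] at this
        simp [this]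
      · simp [ha.ne', hu a ha]
    rw [← this]
    exact Relation.ReflTransGen.refl
  | succ j ih =>
    intro u hu hsum hD
    have hD' : DiffTop 0 (0 + 2 + j) u := by
      rcases Nat.even_or_odd (j + 1) with he | ho
      · rw [show 0 + 2 + j = j + 1 + 1 by omega]
        exact hD he (by rcases he with ⟨r, hr⟩; omega)
      · intro I hI
        have := altSum_of_const hj I (u := u) (u 0)
          (fun a ha => hI a (by omega) (by omega)) hu
        rw [if_pos ho.add_one, sub_zero, hsum] at this
        exact I.eq_top_of_isUnit_mem this hsu
    obtain ⟨v, hr, hv⟩ := exists_reach_isUnit hs j 0 u hD'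
    rw [zero_add] at hv
    have hr' : Reach n u v := hr.mono (by omega)
    have hv0 : ∀ a, j + 1 + 1 ≤ a → v a = 0 := fun a ha => by
      rw [hr.eq_of_le (by omega), hu a ha]
    -- the last difference is a unit, so the last entry can be cleared
    have clear : ∀ w : ℕ → R, (∀ a, j + 1 + 1 ≤ a → w a = 0) → Reach n u w →
        IsUnit (w j - w (j + 1)) →
        ∃ t, (∀ a, j + 1 ≤ a → twist j t w a = 0) ∧ Reach n u (twist j t w) := by
      intro w hw hrw hunit
      obtain ⟨c, hc⟩ := hunit.exists_left_inv
      refine ⟨-(w (j + 1)) * c, fun a ha => ?_, hrw.trans (reach_twist (by omega) _ _)⟩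
      rcases ha.eq_or_lt with rfl | ha
      · rw [twist_right, mul_assoc, hc]
        ring
      · rw [twist_other (by omega) (by omega), hw a ha]
    by_cases hcase : Even j ∧ 2 ≤ j
    -- The shortened sequence has odd length at least `3`, so its `DiffTop` must be arranged. The
    -- first twist makes the second to last difference `1`; the second twist can then set the last
    -- difference to `-s`. Clearing keeps that difference, so the new last entry is `-s`. If all
    -- entries agree modulo `I`, the alternating sum says that they are `s`, whence `2s ∈ I`.
    · have h2' : IsUnit (2 : R) := h2.resolve_left (by omega)
      obtain ⟨i, rfl⟩ : ∃ i, j = i + 1 := ⟨j - 1, by omega⟩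
      obtain ⟨c, hc⟩ := hv.exists_left_inv
      set v1 := twist (i + 1) ((v i - v (i + 1) - 1) * c) v with hv1
      have e1 : v1 i - v1 (i + 1) = 1 := by
        rw [hv1, twist_other (by omega) (by omega), twist_left, mul_assoc, hc]
        ring
      set v2 := twist i (-s - (v1 (i + 1) - v1 (i + 2))) v1 with hv2
      have e2 : v2 (i + 1) - v2 (i + 1 + 1) = -s := by
        rw [hv2, twist_right, twist_other (by omega) (by omega), e1]
        ring
      have hr2 : Reach n u v2 := (hr'.trans (reach_twist (by omega) _ _)).trans
        (reach_twist (by omega) _ _)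
      have hz2 : ∀ a, i + 1 + 1 + 1 ≤ a → v2 a = 0 := fun a ha => by
        rw [hv2, twist_other (by omega) (by omega), hv1, twist_other (by omega) (by omega),
          hv0 a ha]
      obtain ⟨t, hz, hrt⟩ := clear v2 hz2 hr2 (by rw [e2]; exact hsu.neg)
      refine hrt.trans (ih (by omega) _ hz (by rw [hrt.altSum_eq, hsum]) fun _ _ => ?_)
      intro I hI
      set w := twist (i + 1) t v2 with hw
      have e3 : w (i + 1) = -s := by
        have h0 := hz (i + 1 + 1) le_rfl
        have : w (i + 1) - w (i + 1 + 1) = -s := by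
          rw [hw, twist_left, twist_right, ← e2]
          ring
        rw [← this, h0, sub_zero]
      have h3 := altSum_of_const (show i + 1 + 1 ≤ n by omega) I (u := w) (w 0)
        (fun a ha => hI a (by omega) ha) hz
      rw [if_neg (by rw [Nat.not_even_iff_odd]; exact hcase.1.add_one), hrt.altSum_eq, hsum] at h3
      have h4 := hI (i + 1) (by omega) (by omega)
      rw [e3] at h4
      refine I.eq_top_of_isUnit_mem ?_ (h2'.mul hsu)
      have := I.sub_mem h3 h4
      convert this using 1
      ring
    · obtain ⟨t, hz, hrt⟩ := clear v hv0 hr' hv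
      exact hrt.trans (ih (by omega) _ hz (by rw [hrt.altSum_eq, hsum])
        fun h h' => absurd ⟨h, h'⟩ hcase)

end Sequences

/-! ### The Burau representation and its reductions -/

theorem burau_sigma {n : ℕ} (i : Fin (n - 1)) : burau n (sigma i) = burauGen i :=
  PresentedGroup.toGroup.of _

theorem burau_sigma_zpow {n : ℕ} (i : Fin (n - 1)) (z : ℤ) :
    (burau n (sigma i ^ z)).1.1 = 1 + z • Matrix.vecMulVec (colVec i) (rowVec i) := by
  have h := nil_sq i
  have h1 : (burau n (sigma i)).1.1 = 1 + Matrix.vecMulVec (colVec i) (rowVec i) := by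
    rw [burau_sigma]
    exact burauMatrix_eq i
  have h2 : ((burau n (sigma i))⁻¹).1.1 = 1 - Matrix.vecMulVec (colVec i) (rowVec i) := by
    rw [burau_sigma]
    change 2 - burauMatrix i = _
    rw [burauMatrix_eq, ← one_add_one_eq_two]
    abel
  rw [map_zpow]
  set N := Matrix.vecMulVec (colVec i) (rowVec i)
  induction z using Int.induction_on with
  | zero => simp
  | succ k ih =>
    rw [zpow_add_one, Subgroup.coe_mul, Units.val_mul, ih, h1]
    simp only [mul_add, add_mul, smul_mul_assoc, h, add_smul, mul_one, one_mul, smul_zero, one_smul]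
    abel
  | pred k ih =>
    rw [zpow_sub_one, Subgroup.coe_mul, Units.val_mul, ih, h2]
    simp only [mul_sub, add_mul, smul_mul_assoc, h, sub_smul, mul_one, one_mul, smul_zero, one_smul]
    abel

theorem Gam_gram {n : ℕ} (A : Gam n) : A.1.1.transpose * gram n * A.1.1 = gram n := by
  ext a b
  have h := A.2.1 (Pi.single a 1) (Pi.single b 1)
  simp only [form] at h
  rw [Matrix.mulVec_mulVec, ← Matrix.vecMul_transpose, ← Matrix.dotProduct_mulVec,
    Matrix.mulVec_mulVec, ← mul_assoc] at h
  simpa [single_dotProduct, Matrix.mulVec_single_one] using h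

/-! ### Surjectivity of the Burau representation over quotients of `ℤ` -/

section Mod

variable (R : Type*) [CommRing R]

/-- The Burau representation with coefficients in `R`. -/
def burauMod (n : ℕ) : Braid n →* Matrix (Fin n) (Fin n) R :=
  (RingHom.toMonoidHom (Int.castRingHom R).mapMatrix).comp
    ((Units.coeHom _).comp ((Gam n).subtype.comp (burau n)))

variable {R}

theorem burauMod_apply {n : ℕ} (b : Braid n) (a c : Fin n) :
    burauMod R n b a c = (((burau n b).1.1 a c : ℤ) : R) := rfl

/-- The matrices over `R` that satisfy the conditions defining `Γ_{n-1}`. -/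
structure IsGam {n : ℕ} (A : Matrix (Fin n) (Fin n) R) : Prop where
  gram_eq : A.transpose * (gram n).map (Int.castRingHom R) * A = (gram n).map (Int.castRingHom R)
  mulVec_eq : A.mulVec (fun _ => 1) = fun _ => 1
  vecMul_eq : A.vecMul (fun a : Fin n => (-1 : R) ^ (a : ℕ)) = fun a : Fin n => (-1 : R) ^ (a : ℕ)
  exists_inv : ∃ B, B * A = 1

theorem IsGam.one {n : ℕ} : IsGam (1 : Matrix (Fin n) (Fin n) R) :=
  ⟨by simp, by simp, by simp, 1, by simp⟩

theorem IsGam.mul {n : ℕ} {A B : Matrix (Fin n) (Fin n) R} (hA : IsGam A) (hB : IsGam B) :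
    IsGam (A * B) := by
  obtain ⟨A', hA'⟩ := hA.exists_inv
  obtain ⟨B', hB'⟩ := hB.exists_inv
  refine ⟨?_, ?_, ?_, B' * A', ?_⟩
  · calc _ = B.transpose * (A.transpose * (gram n).map (Int.castRingHom R) * A) * B := by
          simp only [Matrix.transpose_mul, mul_assoc]
      _ = _ := by rw [hA.gram_eq, hB.gram_eq]
  · rw [← Matrix.mulVec_mulVec, hB.mulVec_eq, hA.mulVec_eq]
  · rw [← Matrix.vecMul_vecMul, hA.vecMul_eq, hB.vecMul_eq]
  · rw [mul_assoc, ← mul_assoc A', hA', one_mul, hB']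

theorem isGam_map {n : ℕ} (A : Gam n) : IsGam (A.1.1.map (Int.castRingHom R)) := by
  refine ⟨?_, ?_, ?_, (A.1⁻¹).1.map (Int.castRingHom R), ?_⟩
  · rw [← Matrix.transpose_map, ← Matrix.map_mul, ← Matrix.map_mul, Gam_gram]
  · ext a
    have := congrArg (Int.castRingHom R) (congrFun A.2.2.1 a)
    rw [RingHom.map_mulVec] at this
    simpa [vVec, Function.comp_def] using this
  · ext a
    have := congrArg (Int.castRingHom R) (congrFun A.2.2.2 a)
    rw [RingHom.map_vecMul] at this
    simpa [wVec, Function.comp_def] using this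
  · rw [← Matrix.map_mul, ← Units.val_mul, inv_mul_cancel, Units.val_one,
      Matrix.map_one _ (map_zero _) (map_one _)]

/-- The coefficient `t` of a twist lifts to an integer `z`, and `σ_i ^ z` realizes the twist. -/
theorem exists_mulVec_of_reach (hs : Function.Surjective (Int.castRingHom R)) {n : ℕ}
    {u u' : ℕ → R} (h : Reach n u u') :
    ∃ b : Braid n, (burauMod R n b).mulVec (fun a => u a) = fun a : Fin n => u' a := by
  induction h with
  | refl => exact ⟨1, by simp⟩
  | @tail v v' _ hs' ih =>
    obtain ⟨b, hb⟩ := ih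
    obtain ⟨i, t, hi', rfl⟩ := hs'
    obtain ⟨z, rfl⟩ := hs t
    refine ⟨sigma ⟨i, by omega⟩ ^ z * b, ?_⟩
    rw [map_mul, ← Matrix.mulVec_mulVec, hb]
    ext a
    have e : burauMod R n (sigma ⟨i, by omega⟩ ^ z) = 1 + (z : R) •
        Matrix.vecMulVec (fun a => ((colVec (n := n) ⟨i, by omega⟩ a : ℤ) : R))
          (fun a => ((rowVec (n := n) ⟨i, by omega⟩ a : ℤ) : R)) := by
      ext a c
      rw [burauMod_apply, burau_sigma_zpow]
      by_cases hac : a = c <;>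
        simp [Matrix.vecMulVec_apply, hac, -zsmul_eq_mul]
    have hd : ∀ f : Fin n → R, (fun a => ((rowVec (n := n) ⟨i, by omega⟩ a : ℤ) : R)) ⬝ᵥ f =
        f ⟨i, by omega⟩ - f ⟨i + 1, hi'⟩ := by
      intro f
      simp [rowVec, lo, hi, dotProduct, Pi.single_apply, sub_mul, Finset.sum_sub_distrib]
    rw [e, Matrix.add_mulVec, Matrix.one_mulVec, Matrix.smul_mulVec, Matrix.vecMulVec_mulVec, hd]
    simp only [Pi.add_apply, Pi.smul_apply, colVec, twist, lo, hi, Pi.single_apply, Fin.ext_iff,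
      smul_eq_mul, MulOpposite.smul_eq_mul_unop, MulOpposite.unop_op, eq_intCast]
    push_cast
    split_ifs <;> ring

/-- The block sum of `A` and the `1 × 1` identity matrix. -/
def extend {n : ℕ} (A : Matrix (Fin n) (Fin n) R) : Matrix (Fin (n + 1)) (Fin (n + 1)) R :=
  Matrix.of fun a b => Fin.lastCases (motive := fun _ => R)
    (Fin.lastCases (motive := fun _ => R) 1 (fun _ => 0) b)
    (fun a' => Fin.lastCases (motive := fun _ => R) 0 (fun b' => A a' b') b) a

theorem extend_castSucc {n : ℕ} (A : Matrix (Fin n) (Fin n) R) (a b : Fin n) :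
    extend A a.castSucc b.castSucc = A a b := by simp [extend]

theorem extend_last {n : ℕ} (A : Matrix (Fin n) (Fin n) R) :
    extend A (Fin.last n) (Fin.last n) = 1 := by simp [extend]

theorem extend_castSucc_last {n : ℕ} (A : Matrix (Fin n) (Fin n) R) (a : Fin n) :
    extend A a.castSucc (Fin.last n) = 0 := by simp [extend]

theorem extend_last_castSucc {n : ℕ} (A : Matrix (Fin n) (Fin n) R) (b : Fin n) :
    extend A (Fin.last n) b.castSucc = 0 := by simp [extend]

theorem extend_one {n : ℕ} : extend (1 : Matrix (Fin n) (Fin n) R) = 1 := by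
  ext a b
  induction a using Fin.lastCases <;> induction b using Fin.lastCases <;>
    simp [extend_castSucc, extend_last, extend_castSucc_last, extend_last_castSucc,
      Matrix.one_apply, Fin.castSucc_ne_last, (Fin.castSucc_ne_last _).symm]

theorem extend_mul {n : ℕ} (A B : Matrix (Fin n) (Fin n) R) :
    extend (A * B) = extend A * extend B := by
  ext a b
  induction a using Fin.lastCases <;> induction b using Fin.lastCases <;>
    simp [extend_castSucc, extend_last, extend_castSucc_last, extend_last_castSucc,
      Matrix.mul_apply, Fin.sum_univ_castSucc]

/-- The stabilization `GL_n(ℤ) → GL_{n+1}(ℤ)`. -/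
def extendGL (n : ℕ) : GL (Fin n) ℤ →* GL (Fin (n + 1)) ℤ :=
  Units.map { toFun := extend, map_one' := extend_one, map_mul' := extend_mul }

theorem extend_burauMatrix {n : ℕ} (i : Fin (n - 1)) :
    extend (burauMatrix i) = burauMatrix (n := n + 1) ⟨i, by omega⟩ := by
  have := i.2
  ext a b
  induction a using Fin.lastCases <;> induction b using Fin.lastCases <;>
    simp only [extend_castSucc, extend_last, extend_castSucc_last, extend_last_castSucc,
      burauMatrix, Matrix.of_apply, lo, hi, Fin.ext_iff, Fin.val_castSucc, Fin.val_last] <;>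
    split_ifs <;> first | rfl | omega

theorem exists_burau_eq_extend {n : ℕ} (b : Braid n) :
    ∃ b' : Braid (n + 1), (burau (n + 1) b').1.1 = extend (burau n b).1.1 := by
  let H : Subgroup (Braid n) := (((Gam (n + 1)).subtype.comp (burau (n + 1))).range).comap
    ((extendGL n).comp ((Gam n).subtype.comp (burau n)))
  have hH : b ∈ H := by
    refine PresentedGroup.generated_by _ H (fun i => ?_) b
    refine ⟨sigma ⟨i, by omega⟩, Units.ext ?_⟩
    change (burau (n + 1) (sigma _)).1.1 = extend (burau n (sigma i)).1.1
    rw [burau_sigma, burau_sigma]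
    exact (extend_burauMatrix i).symm
  obtain ⟨b', hb'⟩ := hH
  exact ⟨b', congrArg Units.val hb'⟩

theorem exists_burauMod_eq_extend {n : ℕ} (b : Braid n) :
    ∃ b' : Braid (n + 1), burauMod R (n + 1) b' = extend (burauMod R n b) := by
  obtain ⟨b', hb'⟩ := exists_burau_eq_extend b
  refine ⟨b', ?_⟩
  ext a c
  rw [burauMod_apply, hb']
  induction a using Fin.lastCases <;> induction c using Fin.lastCases <;>
    simp [extend_castSucc, extend_last, extend_castSucc_last, extend_last_castSucc,
      burauMod_apply]

/-- Let `u` be the last column. Invariance of the alternating row gives its alternating sum. A left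
inverse `B` of `A` also fixes the all-ones vector `v`, so `B (u - u_0 v) = e_last - u_0 v`. An ideal
with all differences of `u` thus contains `1 - u_0` and `-u_0`, hence `1`. The target vector does
not depend on `A`. -/
theorem IsGam.exists_mulVec_col (hs : Function.Surjective (Int.castRingHom R)) {n : ℕ}
    (h2 : n + 1 ≤ 3 ∨ IsUnit (2 : R)) {A : Matrix (Fin (n + 1)) (Fin (n + 1)) R} (hA : IsGam A) :
    ∃ b : Braid (n + 1), (burauMod R (n + 1) b).mulVec (A.col (Fin.last n)) =
      fun a : Fin (n + 1) => if (a : ℕ) = 0 then (-1) ^ n else 0 := by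
  set u : ℕ → R := fun a => if h : a < n + 1 then A ⟨a, h⟩ (Fin.last n) else 0 with hu
  have hu' : ∀ a : Fin (n + 1), u a = A a (Fin.last n) := fun a => dif_pos a.2
  have hR := reach_single hs h2 ((isUnit_one.neg).pow n : IsUnit ((-1 : R) ^ n)) n le_rfl u
    (fun a ha => dif_neg (by omega)) (by
      have := congrFun hA.vecMul_eq (Fin.last n)
      simp only [Matrix.vecMul, dotProduct, Fin.val_last] at this
      rw [← this, altSum, ← Fin.sum_univ_eq_sum_range (fun a => (-1) ^ a * u a)]
      exact Finset.sum_congr rfl fun a _ => by rw [hu']) (fun _ hn I hI => by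
    obtain ⟨B, hB⟩ := hA.exists_inv
    have hBv : ∀ a, ∑ c, B a c = 1 := by
      intro a
      have : B.mulVec (A.mulVec fun _ => 1) = fun _ => 1 := by
        rw [Matrix.mulVec_mulVec, hB, Matrix.one_mulVec]
      rw [hA.mulVec_eq] at this
      simpa [Matrix.mulVec, dotProduct] using congrFun this a
    have key : ∀ a, (1 : Matrix (Fin (n + 1)) (Fin (n + 1)) R) a (Fin.last n) - u 0 ∈ I := by
      intro a
      have : (1 : Matrix (Fin (n + 1)) (Fin (n + 1)) R) a (Fin.last n) - u 0 =
          ∑ c, B a c * (u c - u 0) := by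
        simp only [mul_sub, Finset.sum_sub_distrib, ← Finset.sum_mul, hBv, one_mul, hu']
        rw [← hB, Matrix.mul_apply]
      rw [this]
      exact I.sum_mem fun c _ => I.mul_mem_left _ (hI c (by omega) c.2)
    have k1 := key (Fin.last n)
    have k2 := key 0
    rw [Matrix.one_apply_eq] at k1
    rw [Matrix.one_apply_ne (by simp [Fin.ext_iff]; omega)] at k2
    rw [Ideal.eq_top_iff_one]
    convert I.sub_mem k1 k2 using 1
    ring)
  obtain ⟨b, hb⟩ := exists_mulVec_of_reach hs hR
  refine ⟨b, ?_⟩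
  rw [← hb]
  congr 1
  ext a
  rw [hu']
  rfl

theorem gram_castSucc_last {n : ℕ} (a : Fin (n + 1)) :
    gram (n + 1) a (Fin.last n) = (-1) ^ (n + 1) * ((-1) ^ (a : ℕ) -
      if a = Fin.last n then (-1) ^ n else 0) := by
  rcases (Fin.le_last a).eq_or_lt with rfl | h
  · simp [gram]
  · simp [gram, h, h.ne, pow_add]
    ring

/-- By `gram_castSucc_last`, pairing with `e_last` is, up to sign, the alternating sum minus
`(-1)^n` times the last coordinate. As `A` fixes `e_last` and preserves the form and the alternating
sum, it preserves the last coordinate. So the last row is trivial as well. -/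
theorem IsGam.eq_extend {n : ℕ} {A : Matrix (Fin (n + 1)) (Fin (n + 1)) R} (hA : IsGam A)
    (hcol : ∀ a, A a (Fin.last n) = if a = Fin.last n then 1 else 0) :
    ∃ A' : Matrix (Fin n) (Fin n) R, IsGam A' ∧ A = extend A' := by
  have hrow : ∀ b, A (Fin.last n) b = if b = Fin.last n then 1 else 0 := by
    intro b
    have h1 := congrFun (congrFun hA.gram_eq b) (Fin.last n)
    have h2 := congrFun hA.vecMul_eq b
    rw [Matrix.mul_apply] at h1
    simp only [hcol, mul_ite, mul_one, mul_zero, Finset.sum_ite_eq', Finset.mem_univ, if_true,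
      Matrix.mul_apply, Matrix.transpose_apply, Matrix.map_apply, gram_castSucc_last] at h1
    simp only [Matrix.vecMul, dotProduct] at h2
    have h3 : ∑ x : Fin (n + 1), A x b * (-1 : R) ^ (x : ℕ) = (-1) ^ (b : ℕ) := by
      rw [← h2]
      exact Finset.sum_congr rfl fun _ _ => mul_comm _ _
    have hu : IsUnit ((-1 : R) ^ n) := isUnit_one.neg.pow n
    have hu' : IsUnit ((-1 : R) ^ (n + 1)) := isUnit_one.neg.pow _
    simp only [map_mul, map_sub, map_pow, map_neg, map_one, apply_ite (Int.castRingHom R),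
      map_zero, mul_left_comm _ ((-1 : R) ^ (n + 1)), ← Finset.mul_sum, mul_sub,
      Finset.sum_sub_distrib, h3, mul_ite, mul_zero, Finset.sum_ite_eq', Finset.mem_univ,
      if_true] at h1
    have h4 : (-1 : R) ^ (n + 1) * (-1) ^ n * A (Fin.last n) b =
        (-1 : R) ^ (n + 1) * (-1) ^ n * if b = Fin.last n then 1 else 0 := by
      split_ifs at h1 ⊢ <;> linear_combination -h1
    exact (hu'.mul hu).mul_left_cancel h4
  have hcol' : ∀ a : Fin n, A a.castSucc (Fin.last n) = 0 := fun a => by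
    rw [hcol, if_neg (Fin.castSucc_ne_last a)]
  have hrow' : ∀ a : Fin n, A (Fin.last n) a.castSucc = 0 := fun a => by
    rw [hrow, if_neg (Fin.castSucc_ne_last a)]
  have hll : A (Fin.last n) (Fin.last n) = 1 := by rw [hcol, if_pos rfl]
  refine ⟨A.submatrix Fin.castSucc Fin.castSucc, ⟨?_, ?_, ?_, ?_⟩, ?_⟩
  · ext a b
    have h := congrFun (congrFun hA.gram_eq a.castSucc) b.castSucc
    simp only [Matrix.mul_apply, Fin.sum_univ_castSucc, Matrix.transpose_apply, hrow', zero_mul,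
      mul_zero, add_zero] at h
    simp only [Matrix.mul_apply, Matrix.transpose_apply, Matrix.submatrix_apply]
    simpa [gram, Fin.ext_iff] using h
  · ext a
    have h := congrFun hA.mulVec_eq a.castSucc
    simpa [Matrix.mulVec, dotProduct, Fin.sum_univ_castSucc, hcol'] using h
  · ext a
    have h := congrFun hA.vecMul_eq a.castSucc
    simpa [Matrix.vecMul, dotProduct, Fin.sum_univ_castSucc, hrow'] using h
  · obtain ⟨B, hB⟩ := hA.exists_inv
    refine ⟨B.submatrix Fin.castSucc Fin.castSucc, ?_⟩
    ext a b
    have h := congrFun (congrFun hB a.castSucc) b.castSucc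
    simpa [Matrix.mul_apply, Fin.sum_univ_castSucc, hrow', Matrix.one_apply] using h
  · ext a b
    induction a using Fin.lastCases <;> induction b using Fin.lastCases <;>
      simp [extend_castSucc, extend_last, extend_castSucc_last, extend_last_castSucc, hcol', hrow',
        hll]

/-- If `n ≤ 3` or if `2` is invertible in the quotient `R` of `ℤ`, then the braid group maps onto
the analogue of `Γ_{n-1}` over `R`. -/
theorem exists_burauMod_eq (hs : Function.Surjective (Int.castRingHom R)) (n : ℕ) :
    (n ≤ 3 ∨ IsUnit (2 : R)) → ∀ {A : Matrix (Fin n) (Fin n) R}, IsGam A →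
      ∃ b : Braid n, burauMod R n b = A := by
  induction n with
  | zero => exact fun _ A _ => ⟨1, Subsingleton.elim _ _⟩
  | succ n ih =>
    intro h2 A hA
    obtain ⟨b₁, h₁⟩ := hA.exists_mulVec_col hs h2
    -- The identity matrix leads to the same target, so `b₂⁻¹ * b₁` carries the last column of `A`
    -- to `e_last`.
    obtain ⟨b₂, h₂⟩ := IsGam.one.exists_mulVec_col hs h2
    have hb : IsGam (burauMod R (n + 1) (b₂⁻¹ * b₁)) := isGam_map (burau (n + 1) (b₂⁻¹ * b₁))
    have hcol : ∀ a, (burauMod R (n + 1) (b₂⁻¹ * b₁) * A) a (Fin.last n) =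
        if a = Fin.last n then 1 else 0 := by
      intro a
      have : (burauMod R (n + 1) (b₂⁻¹ * b₁)).mulVec (A.col (Fin.last n)) =
          (1 : Matrix (Fin (n + 1)) (Fin (n + 1)) R).col (Fin.last n) := by
        rw [map_mul, ← Matrix.mulVec_mulVec, h₁, ← h₂, Matrix.mulVec_mulVec, ← map_mul,
          inv_mul_cancel, map_one, Matrix.one_mulVec]
      have := congrFun this a
      rw [Matrix.col_apply, Matrix.one_apply] at this
      exact this
    obtain ⟨A', hA', e⟩ := (hb.mul hA).eq_extend hcol
    obtain ⟨b', hb'⟩ := ih (h2.imp (by omega) id) hA'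
    obtain ⟨b'', hb''⟩ := exists_burauMod_eq_extend (R := R) b'
    refine ⟨(b₂⁻¹ * b₁)⁻¹ * b'', ?_⟩
    rw [map_mul, hb'', hb', ← e, ← mul_assoc, ← map_mul, inv_mul_cancel, map_one, one_mul]

end Mod

/-! ### Congruence subgroups -/

theorem mem_BraidLevel {n : ℕ} {d : ℤ} {b : Braid n} :
    b ∈ BraidLevel n d ↔ burau n b ∈ GamLevel n d := Iff.rfl

theorem mem_GamLevel_iff_map {n : ℕ} {d : ℤ} {R : Type*} [CommRing R]
    (hR : ∀ z : ℤ, (z : R) = 0 ↔ d ∣ z) {A : Gam n} :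
    A ∈ GamLevel n d ↔ A.1.1.map (Int.castRingHom R) = 1 := by
  rw [mem_GamLevel, ← Matrix.ext_iff]
  refine forall_congr' fun a => forall_congr' fun b => ?_
  rw [← hR, Int.cast_sub, sub_eq_zero]
  rcases eq_or_ne a b with rfl | h
  · rw [Matrix.one_apply_eq, Matrix.one_apply_eq, Int.cast_one]
    rfl
  · rw [Matrix.one_apply_ne h, Matrix.one_apply_ne h, Int.cast_zero]
    rfl

theorem inv_mul_mem_GamLevel {n : ℕ} {d : ℤ} {A B : Gam n}
    (h : ∀ a b, d ∣ A.1.1 a b - B.1.1 a b) : B⁻¹ * A ∈ GamLevel n d := by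
  rw [mem_GamLevel]
  intro a b
  have e : (B⁻¹ * A).1.1 - 1 = (B⁻¹).1.1 * (A.1.1 - B.1.1) := by
    rw [mul_sub, Subgroup.coe_mul, Units.val_mul, Subgroup.coe_inv, ← Units.val_mul B.1⁻¹ B.1,
      inv_mul_cancel, Units.val_one]
  rw [← Matrix.sub_apply, e, Matrix.mul_apply]
  exact Finset.dvd_sum fun c _ => (h c b).mul_left _

theorem exists_eq_one_add_smul {n : ℕ} {d : ℤ} {A : Gam n} (h : A ∈ GamLevel n d) :
    ∃ N : Matrix (Fin n) (Fin n) ℤ, A.1.1 = 1 + d • N := by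
  choose N hN using mem_GamLevel.1 h
  refine ⟨Matrix.of N, ?_⟩
  ext a b
  have := hN a b
  simp only [Matrix.add_apply, Matrix.smul_apply, Matrix.of_apply, smul_eq_mul]
  linarith

/-! ### Reduction modulo `2` -/

theorem intCast_zmod_two_eq_zero (z : ℤ) : (z : ZMod 2) = 0 ↔ 2 ∣ z :=
  ZMod.intCast_zmod_eq_zero_iff_dvd z 2

theorem two_dvd_sub_of_eq {x y : ℤ} (h : (x : ZMod 2) = y) : 2 ∣ x - y := by
  rw [← intCast_zmod_two_eq_zero, Int.cast_sub, h, sub_self]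

/-- The permutation matrix over `ℤ/2ℤ` that sends `e_b` to `e_{τ b}`. -/
def permMat (n : ℕ) : Equiv.Perm (Fin n) →* Matrix (Fin n) (Fin n) (ZMod 2) where
  toFun τ := Matrix.of fun a b => if a = τ b then 1 else 0
  map_one' := by
    ext a b
    rw [Matrix.one_apply]
    rfl
  map_mul' σ τ := by
    ext a b
    simp only [Matrix.mul_apply, Matrix.of_apply, mul_ite, mul_one, mul_zero, Finset.sum_ite_eq',
      Finset.mem_univ, if_true]
    rfl

theorem permMat_apply {n : ℕ} (τ : Equiv.Perm (Fin n)) (a b : Fin n) :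
    permMat n τ a b = if a = τ b then 1 else 0 := rfl

theorem permMat_injective (n : ℕ) : Function.Injective (permMat n) := by
  intro σ τ h
  ext b : 1
  have := congrFun (congrFun h (σ b)) b
  by_contra hne
  simp [permMat_apply, hne] at this

theorem permMat_conj {n : ℕ} (τ : Equiv.Perm (Fin n)) (M : Matrix (Fin n) (Fin n) (ZMod 2))
    (a b : Fin n) : (permMat n τ * M * permMat n τ⁻¹) a b = M (τ⁻¹ a) (τ⁻¹ b) := by
  have h1 : ∀ (c : Fin n), (permMat n τ * M) a c = M (τ⁻¹ a) c := by
    intro c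
    rw [Matrix.mul_apply, Finset.sum_eq_single (τ⁻¹ a)]
    · simp [permMat_apply]
    · intro x _ hx
      rw [permMat_apply, if_neg (fun h => hx (by simp [h])), zero_mul]
    · simp
  rw [Matrix.mul_apply]
  simp [h1, permMat_apply]

theorem burauMod_two_sigma {n : ℕ} (i : Fin (n - 1)) :
    burauMod (ZMod 2) n (sigma i) = permMat n (Equiv.swap (lo i) (hi i)) := by
  have hne : lo i ≠ hi i := by simp [lo, hi]
  have h2 : (2 : ZMod 2) = 0 := rfl
  have h1 : (-1 : ZMod 2) = 1 := rfl
  ext a b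
  rw [burauMod_apply, burau_sigma]
  change ((burauMatrix i a b : ℤ) : ZMod 2) = _
  rw [permMat_apply, Equiv.swap_apply_def, burauMatrix, Matrix.of_apply]
  split_ifs <;> simp_all

/-- The relations are inherited from the Burau matrices, which become permutation matrices modulo
`2`, because `permMat` is injective. -/
theorem permutation_relators {n : ℕ} : ∀ r ∈ artinRelators n,
    FreeGroup.lift (fun i : Fin (n - 1) => Equiv.swap (lo i) (hi i)) r = 1 := by
  intro r hr
  have h : (permMat n).comp (FreeGroup.lift fun i : Fin (n - 1) => Equiv.swap (lo i) (hi i)) =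
      (burauMod (ZMod 2) n).comp (PresentedGroup.mk (artinRelators n)) := by
    refine FreeGroup.ext_hom _ _ fun i => ?_
    simp only [MonoidHom.comp_apply, FreeGroup.lift_apply_of]
    exact (burauMod_two_sigma i).symm
  apply permMat_injective n
  have := DFunLike.congr_fun h r
  rw [MonoidHom.comp_apply, MonoidHom.comp_apply, PresentedGroup.one_of_mem hr, map_one] at this
  rw [this, map_one]

/-- The permutation of the strands that underlies a braid. -/
def permutation (n : ℕ) : Braid n →* Equiv.Perm (Fin n) :=
  PresentedGroup.toGroup permutation_relators

theorem permutation_sigma {n : ℕ} (i : Fin (n - 1)) :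
    permutation n (sigma i) = Equiv.swap (lo i) (hi i) := PresentedGroup.toGroup.of _

theorem burauMod_two {n : ℕ} (b : Braid n) :
    burauMod (ZMod 2) n b = permMat n (permutation n b) := by
  have : burauMod (ZMod 2) n = (permMat n).comp (permutation n) := by
    let u : Braid n →* (Matrix (Fin n) (Fin n) (ZMod 2))ˣ := (burauMod (ZMod 2) n).toHomUnits
    let v : Braid n →* (Matrix (Fin n) (Fin n) (ZMod 2))ˣ :=
      ((permMat n).comp (permutation n)).toHomUnits
    have huv : u = v := by
      refine PresentedGroup.ext fun i => Units.ext ?_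
      change burauMod (ZMod 2) n (sigma i) = permMat n (permutation n (sigma i))
      rw [burauMod_two_sigma, permutation_sigma]
    ext1 b
    exact congrArg Units.val (DFunLike.congr_fun huv b)
  rw [this, MonoidHom.comp_apply]

theorem permutation_surjective (n : ℕ) : Function.Surjective (permutation n) := by
  rw [← MonoidHom.range_eq_top]
  rcases n with _ | n
  · exact Subsingleton.elim _ _
  · rw [eq_top_iff]
    intro τ _
    have hτ : τ ∈ Submonoid.closure
        (Set.range fun i : Fin n => Equiv.swap i.castSucc i.succ) := by
      rw [Equiv.Perm.mclosure_swap_castSucc_succ]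
      trivial
    refine (Submonoid.closure_le (S := (permutation (n + 1)).range.toSubmonoid)).2 ?_ hτ
    rintro _ ⟨i, rfl⟩
    exact ⟨sigma i, permutation_sigma (n := n + 1) i⟩

theorem mem_GamLevel_two {n : ℕ} {b : Braid n} :
    burau n b ∈ GamLevel n 2 ↔ permutation n b = 1 := by
  rw [mem_GamLevel_iff_map intCast_zmod_two_eq_zero,
    ← (permMat_injective n).eq_iff, map_one, ← burauMod_two]
  rfl

/-! ### The successive quotients of the `2`-power congruence subgroups -/

/-- `N` is symmetric modulo `2` with vanishing row sums, if `1 + 2^j N` lies in `Γ_{n-1}`. -/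
theorem symm_of_one_add_smul {n j : ℕ} (hj : 1 ≤ j) {A : Gam n} {N : Matrix (Fin n) (Fin n) ℤ}
    (h : A.1.1 = 1 + (2 ^ j : ℤ) • N) :
    (N.map (Int.castRingHom (ZMod 2))).transpose = N.map (Int.castRingHom (ZMod 2)) ∧
      ∀ a, ∑ b, N.map (Int.castRingHom (ZMod 2)) a b = 0 := by
  have hj0 : (2 ^ j : ℤ) ≠ 0 := pow_ne_zero _ two_ne_zero
  have hv : N.mulVec (vVec n) = 0 := by
    have := A.2.2.1
    rw [h, Matrix.add_mulVec, Matrix.one_mulVec, Matrix.smul_mulVec, add_eq_left] at this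
    exact (smul_eq_zero.1 this).resolve_left hj0
  have hw : Matrix.vecMul (wVec n) N = 0 := by
    have := A.2.2.2
    rw [h, Matrix.vecMul_add, Matrix.vecMul_one, Matrix.vecMul_smul, add_eq_left] at this
    exact (smul_eq_zero.1 this).resolve_left hj0
  have hG : N.transpose * gram n + gram n * N + (2 ^ j : ℤ) • (N.transpose * gram n * N) = 0 := by
    have := Gam_gram A
    rw [h, Matrix.transpose_add, Matrix.transpose_one, Matrix.transpose_smul] at this
    have e : (2 ^ j : ℤ) • (N.transpose * gram n + gram n * N +
        (2 ^ j : ℤ) • (N.transpose * gram n * N)) = 0 := by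
      rw [← sub_eq_zero.2 this]
      simp only [add_mul, mul_add, one_mul, mul_one, smul_mul_assoc, mul_smul_comm, smul_add]
      abel
    exact (smul_eq_zero.1 e).resolve_left hj0
  set M := N.map (Int.castRingHom (ZMod 2)) with hM
  have hcol : ∀ b, ∑ a, M a b = 0 := by
    intro b
    have := congrArg (Int.castRingHom (ZMod 2)) (congrFun hw b)
    rw [RingHom.map_vecMul] at this
    simp only [Matrix.vecMul, dotProduct, Function.comp_apply, wVec, map_pow, map_neg, map_one,
      show (-1 : ZMod 2) = 1 from rfl, one_pow, one_mul, Pi.zero_apply, map_zero] at this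
    exact this
  refine ⟨?_, fun a => ?_⟩
  -- Modulo `2` the Gram matrix `G` is the all-ones matrix minus the identity. Since the column sums
  -- of `N` vanish, `G N = N` and `Nᵀ G = Nᵀ` there. The quadratic term of `hG` drops out because `j
  -- ≥ 1`.
  · have hgram : ∀ a b, (Int.castRingHom (ZMod 2)) (gram n a b) = if a = b then 0 else 1 := by
      intro a b
      rw [gram, Matrix.of_apply]
      split_ifs with h1 h2
      · exact absurd h1 (by simp [h2])
      · simp [show (-1 : ZMod 2) = 1 from rfl]
      · simp
      · simp [show (-1 : ZMod 2) = 1 from rfl]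
    have hsum : ∀ (f : Fin n → ZMod 2) (a : Fin n), ∑ c, f c = 0 →
        ∑ c, f c * (if c = a then 0 else 1) = f a := by
      intro f a hf
      have : ∀ c, f c * (if c = a then 0 else 1) = f c - if c = a then f c else 0 := by
        intro c
        split_ifs <;> simp
      simp only [this, Finset.sum_sub_distrib, hf, Finset.sum_ite_eq', Finset.mem_univ, if_true,
        zero_sub, CharTwo.neg_eq]
    ext a b
    have e := congrArg (Int.castRingHom (ZMod 2)) (congrFun (congrFun hG a) b)
    have h2 : (Int.castRingHom (ZMod 2)) (2 ^ j) = 0 := by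
      rw [map_pow, map_ofNat, show (OfNat.ofNat 2 : ZMod 2) = 0 from rfl, zero_pow (by omega)]
    rw [Matrix.add_apply, Matrix.add_apply, Matrix.smul_apply, smul_eq_mul, map_add, map_add,
      map_mul, h2, zero_mul, add_zero, Matrix.mul_apply, Matrix.mul_apply, map_sum, map_sum] at e
    simp only [map_mul, hgram, Matrix.zero_apply, map_zero, Matrix.transpose_apply] at e
    have e1 := hsum (fun c => M c a) b (hcol a)
    have e2 := hsum (fun c => M c b) a (hcol b)
    simp only [hM, Matrix.map_apply] at e1 e2
    have e3 : ∑ x, (if a = x then (0 : ZMod 2) else 1) * (Int.castRingHom (ZMod 2)) (N x b) =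
        ∑ c, (Int.castRingHom (ZMod 2)) (N c b) * (if c = a then 0 else 1) :=
      Finset.sum_congr rfl fun c _ => by rw [mul_comm]; simp only [eq_comm]
    rw [e1, e3, e2, CharTwo.add_eq_zero] at e
    exact e
  · have := congrArg (Int.castRingHom (ZMod 2)) (congrFun hv a)
    rw [RingHom.map_mulVec] at this
    simp only [Matrix.mulVec, dotProduct, vVec, Function.comp_apply, map_one, mul_one,
      Pi.zero_apply, map_zero] at this
    exact this

/-- The matrix `(e_p + e_q) (e_p + e_q)ᵀ` over `ℤ/2ℤ`. -/
def pairMat {n : ℕ} (p q : Fin n) : Matrix (Fin n) (Fin n) (ZMod 2) :=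
  Matrix.of fun a b => ((if a = p then 1 else 0) + if a = q then 1 else 0) *
    ((if b = p then 1 else 0) + if b = q then 1 else 0)

/-- The `pairMat p q` with `p < q` have disjoint off-diagonal supports, so the two sides agree off
the diagonal. Vanishing row sums then determine the diagonal. -/
theorem eq_sum_pairMat {n : ℕ} {M : Matrix (Fin n) (Fin n) (ZMod 2)} (hM : M.transpose = M)
    (hr : ∀ a, ∑ b, M a b = 0) :
    M = ∑ p, ∑ q, if p < q then M p q • pairMat p q else 0 := by
  set S := ∑ p, ∑ q, if p < q then M p q • pairMat p q else 0 with hS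
  have hoff : ∀ a b, a ≠ b → M a b = S a b := by
    intro a b hab
    have e : ∀ p q, (if p < q then M p q • pairMat p q else 0) a b =
        (if a = p then if b = q then if a < b then M a b else 0 else 0 else 0) +
        (if b = p then if a = q then if b < a then M b a else 0 else 0 else 0) := by
      intro p q
      by_cases hpq : p < q
      · rw [if_pos hpq, Matrix.smul_apply, pairMat, Matrix.of_apply]
        split_ifs <;> simp_all
      · rw [if_neg hpq]
        split_ifs <;> first | (exfalso; subst_vars; exact hpq ‹_›) | simp
    simp only [hS, Matrix.sum_apply, e, Finset.sum_add_distrib, Finset.sum_ite_irrel,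
      Finset.sum_const_zero, Finset.sum_ite_eq, Finset.mem_univ, if_true]
    rcases lt_or_gt_of_ne hab with h | h
    · simp [h, h.not_gt]
    · rw [if_neg h.not_gt, if_pos h, zero_add]
      exact congrFun (congrFun hM.symm a) b
  have hpair : ∀ (p q a : Fin n), ∑ b, pairMat p q a b = 0 := by
    intro p q a
    simp [pairMat, ← Finset.mul_sum, Finset.sum_add_distrib, show (1 + 1 : ZMod 2) = 0 from rfl]
  have hSr : ∀ a, ∑ b, S a b = 0 := by
    intro a
    simp only [hS, Matrix.sum_apply]
    rw [Finset.sum_comm]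
    refine Finset.sum_eq_zero fun p _ => ?_
    rw [Finset.sum_comm]
    refine Finset.sum_eq_zero fun q _ => ?_
    split_ifs
    · simp [← Finset.mul_sum, hpair]
    · simp
  ext a b
  rcases eq_or_ne a b with rfl | hab
  · have h1 := hr a
    have h2 := hSr a
    rw [← Finset.add_sum_erase _ _ (Finset.mem_univ a)] at h1 h2
    rw [Finset.sum_congr rfl fun b hb => hoff a b (Finset.ne_of_mem_erase hb).symm] at h1
    exact add_right_cancel (h1.trans h2.symm)
  · exact hoff a b hab

/-- The matrices `N` modulo `2` for which some `1 + 2^j N` is the image of a braid. -/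
def levelImage (n j : ℕ) (hj : 1 ≤ j) : AddSubmonoid (Matrix (Fin n) (Fin n) (ZMod 2)) where
  carrier := {M | ∃ (b : Braid n) (N : Matrix (Fin n) (Fin n) ℤ),
    (burau n b).1.1 = 1 + (2 ^ j : ℤ) • N ∧ N.map (Int.castRingHom (ZMod 2)) = M}
  zero_mem' := ⟨1, 0, by simp, by ext; simp⟩
  add_mem' := by
    rintro _ _ ⟨b, N, hN, rfl⟩ ⟨b', N', hN', rfl⟩
    refine ⟨b * b', N + N' + (2 ^ j : ℤ) • (N * N'), ?_, ?_⟩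
    · rw [map_mul, Subgroup.coe_mul, Units.val_mul, hN, hN']
      simp only [add_mul, mul_add, one_mul, mul_one, smul_mul_assoc, mul_smul_comm, smul_add]
      abel
    · have h2 : (2 : ZMod 2) = 0 := rfl
      ext a b
      simp [h2, show j ≠ 0 by omega, -zsmul_eq_mul]

theorem conj_mem_levelImage {n j : ℕ} (hj : 1 ≤ j) (τ : Equiv.Perm (Fin n))
    {M : Matrix (Fin n) (Fin n) (ZMod 2)} (hM : M ∈ levelImage n j hj) :
    permMat n τ * M * permMat n τ⁻¹ ∈ levelImage n j hj := by
  obtain ⟨b, N, hN, rfl⟩ := hM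
  obtain ⟨c, rfl⟩ := permutation_surjective n τ
  refine ⟨c * b * c⁻¹, (burau n c).1.1 * N * (burau n c⁻¹).1.1, ?_, ?_⟩
  · have h : (burau n c).1.1 * (burau n c⁻¹).1.1 = 1 := by
      rw [← Units.val_mul, ← Subgroup.coe_mul, ← map_mul, mul_inv_cancel, map_one]
      rfl
    rw [map_mul, map_mul, Subgroup.coe_mul, Subgroup.coe_mul, Units.val_mul, Units.val_mul, hN]
    simp only [mul_add, add_mul, mul_one, h, mul_smul_comm, smul_mul_assoc]
  · rw [Matrix.map_mul, Matrix.map_mul, ← map_inv, ← burauMod_two, ← burauMod_two]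
    rfl

/-- The power `σ_0 ^ (2^j)` gives the first pair of strands. Conjugation by braids permutes the
indices through all of `S_n`, which is transitive on ordered pairs of distinct strands. -/
theorem pairMat_mem_levelImage {n j : ℕ} (hj : 1 ≤ j) {p q : Fin n} (hpq : p ≠ q) :
    pairMat p q ∈ levelImage n j hj := by
  have hn : 1 < n := by
    have := Fin.val_ne_of_ne hpq
    omega
  let i : Fin (n - 1) := ⟨0, by omega⟩
  have hne : lo i ≠ hi i := by simp [lo, hi]
  have h0 : pairMat (lo i) (hi i) ∈ levelImage n j hj := by
    refine ⟨sigma i ^ (2 ^ j : ℤ), _, burau_sigma_zpow i _, ?_⟩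
    ext a b
    simp [pairMat, colVec, rowVec, Matrix.vecMulVec_apply, Pi.single_apply, CharTwo.sub_eq_add,
      Matrix.map_apply]
  obtain ⟨τ, h1, h2⟩ : ∃ τ : Equiv.Perm (Fin n), τ (lo i) = p ∧ τ (hi i) = q := by
    refine ⟨Equiv.swap (Equiv.swap (lo i) p (hi i)) q * Equiv.swap (lo i) p, ?_, ?_⟩
    · rw [Equiv.Perm.mul_apply, Equiv.swap_apply_left, Equiv.swap_apply_of_ne_of_ne _ hpq]
      intro h
      have := congrArg (Equiv.swap (lo i) p) h
      rw [Equiv.swap_apply_right, Equiv.swap_apply_self] at this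
      exact hne this
    · rw [Equiv.Perm.mul_apply, Equiv.swap_apply_left]
  have := conj_mem_levelImage hj τ h0
  convert this using 1
  ext a b
  have hx : ∀ a c, τ⁻¹ a = c ↔ a = τ c := fun a c => Equiv.Perm.inv_eq_iff_eq
  rw [permMat_conj]
  simp only [pairMat, Matrix.of_apply, hx, h1, h2]

theorem exists_mem_GamLevel_succ {n j : ℕ} (hj : 1 ≤ j) {A : Gam n}
    (hA : A ∈ GamLevel n (2 ^ j)) :
    ∃ b : Braid n, (burau n b)⁻¹ * A ∈ GamLevel n (2 ^ (j + 1)) := by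
  obtain ⟨N, hN⟩ := exists_eq_one_add_smul hA
  obtain ⟨h1, h2⟩ := symm_of_one_add_smul hj hN
  have hmem : N.map (Int.castRingHom (ZMod 2)) ∈ levelImage n j hj := by
    rw [eq_sum_pairMat h1 h2]
    refine sum_mem fun p _ => sum_mem fun q _ => ?_
    split_ifs with hpq
    · rcases (by decide : ∀ c : ZMod 2, c = 0 ∨ c = 1) (N.map (Int.castRingHom (ZMod 2)) p q) with
        h | h
      · rw [h, zero_smul]
        exact zero_mem _
      · rw [h, one_smul]
        exact pairMat_mem_levelImage hj hpq.ne
    · exact zero_mem _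
  obtain ⟨b, N', hb, hN'⟩ := hmem
  refine ⟨b, inv_mul_mem_GamLevel fun a c => ?_⟩
  have h3 : (2 : ℤ) ∣ N a c - N' a c :=
    two_dvd_sub_of_eq (congrFun (congrFun hN' a) c).symm
  rw [hN, hb]
  simp only [Matrix.add_apply, Matrix.smul_apply, smul_eq_mul, add_sub_add_left_eq_sub]
  rw [← mul_sub, pow_succ]
  exact mul_dvd_mul_left _ h3

/-- The image of the braid group is dense in `Γ_{n-1}[2]` for the `2`-adic topology. -/
theorem exists_mem_GamLevel_two_pow {n k : ℕ} (hk : 1 ≤ k) {A : Gam n} (hA : A ∈ GamLevel n 2) :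
    ∃ b : Braid n, (burau n b)⁻¹ * A ∈ GamLevel n (2 ^ k) := by
  induction k, hk using Nat.le_induction with
  | base => exact ⟨1, by simpa using hA⟩
  | succ k hk ih =>
    obtain ⟨b, hb⟩ := ih
    obtain ⟨b', hb'⟩ := exists_mem_GamLevel_succ hk hb
    exact ⟨b * b', by rwa [map_mul, mul_inv_rev, mul_assoc]⟩

/-- No lift to `Γ_{n-1}` of a transposition is an involution modulo `4`. -/
theorem mul_self_notMem_GamLevel_four {n : ℕ} (i : Fin (n - 1)) {A : Gam n}
    (hA : (burau n (sigma i))⁻¹ * A ∈ GamLevel n 2) : A * A ∉ GamLevel n 4 := by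
  intro h4
  have hne : lo i ≠ hi i := by simp [lo, hi]
  have hA' : (burau n (sigma i))⁻¹ * A ∈ GamLevel n (2 ^ 1) := by rwa [pow_one]
  obtain ⟨N, hN⟩ := exists_eq_one_add_smul hA'
  obtain ⟨hs, -⟩ := symm_of_one_add_smul le_rfl hN
  have hN' : A.1.1 = burauMatrix i * (1 + (2 : ℤ) • N) := by
    rw [← pow_one (2 : ℤ), ← hN, Subgroup.coe_mul, Units.val_mul, ← mul_assoc, Subgroup.coe_inv,
      burau_sigma]
    change _ = (burauGL i).1 * (burauGL i)⁻¹.1 * _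
    rw [← Units.val_mul, mul_inv_cancel, Units.val_one, one_mul]
  have hsym : (2 : ℤ) ∣ N (lo i) (hi i) - N (hi i) (lo i) :=
    two_dvd_sub_of_eq (congrFun (congrFun hs (lo i)) (hi i)).symm
  -- Put `B = burauMatrix i`. The `(lo, hi)` entry of `B²` is `-2`. Modulo `2`, `B²` is the identity
  -- and `B` the transposition, so that entry of `B² N + B N B` is `N(lo, hi) + N(hi, lo)`, which is
  -- even by symmetry. Hence the entry of `A²` is `2` modulo `4`.
  have hsq : (A * A).1.1 = burauMatrix i * burauMatrix i + (2 : ℤ) •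
      (burauMatrix i * burauMatrix i * N + burauMatrix i * N * burauMatrix i) +
      (4 : ℤ) • (burauMatrix i * N * burauMatrix i * N) := by
    rw [Subgroup.coe_mul, Units.val_mul, hN', show (4 : ℤ) = 2 * 2 by norm_num, mul_smul]
    simp only [mul_add, add_mul, mul_one, mul_smul_comm, smul_mul_assoc, smul_add, mul_assoc]
    abel
  have e := mem_GamLevel.1 h4 (lo i) (hi i)
  have hB1 : ∀ (X : Matrix (Fin n) (Fin n) ℤ) b,
      (burauMatrix i * X) (lo i) b = 2 * X (lo i) b - X (hi i) b := by
    intro X b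
    rw [burauMatrix_eq, add_mul, one_mul, Matrix.add_apply, Matrix.vecMulVec_mul,
      Matrix.vecMulVec_apply]
    simp [colVec, rowVec, hne, Matrix.sub_vecMul]
    ring
  have hB2 : ∀ (X : Matrix (Fin n) (Fin n) ℤ) b,
      (burauMatrix i * X) (hi i) b = X (lo i) b := by
    intro X b
    rw [burauMatrix_eq, add_mul, one_mul, Matrix.add_apply, Matrix.vecMulVec_mul,
      Matrix.vecMulVec_apply]
    simp [colVec, rowVec, hne.symm, Matrix.sub_vecMul]
  have hB3 : ∀ (X : Matrix (Fin n) (Fin n) ℤ) a,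
      (X * burauMatrix i) a (hi i) = - X a (lo i) := by
    intro X b
    rw [burauMatrix_eq, mul_add, mul_one, Matrix.add_apply, Matrix.mul_vecMulVec,
      Matrix.vecMulVec_apply]
    simp [colVec, rowVec, hne.symm, Matrix.mulVec_add]
  have hb1 : burauMatrix i (lo i) (hi i) = -1 := by simp [burauMatrix, hne.symm]
  have hb2 : burauMatrix i (hi i) (hi i) = 0 := by simp [burauMatrix, hne.symm]
  rw [hsq] at e
  simp only [Matrix.add_apply, Matrix.smul_apply, smul_eq_mul, mul_assoc, hB1, hB2, hB3, hb1, hb2,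
    Matrix.one_apply_ne hne] at e
  omega

/-! ### The symplectic description of `Γ_{n-1}` -/

theorem form_mulVec_of_gram {n : ℕ} {A : Matrix (Fin n) (Fin n) ℤ}
    (hA : A.transpose * gram n * A = gram n) (v w : Fin n → ℤ) :
    form (A.mulVec v) (A.mulVec w) = form v w := by
  rw [form, form, Matrix.mulVec_mulVec, ← Matrix.vecMul_transpose, ← Matrix.dotProduct_mulVec,
    Matrix.mulVec_mulVec, ← Matrix.mul_assoc, hA]

/-- A partial symplectic basis `P` of `ℤⁿ` whose complementary projection `E` is fixed by
`Γ_{n-1}` on both sides and lies in the radical of the form. -/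
structure SpFrame (n : ℕ) {κ : Type} [Fintype κ] [DecidableEq κ]
    (P : Matrix (Fin n) (κ ⊕ κ) ℤ) (E : Matrix (Fin n) (Fin n) ℤ) : Prop where
  gram_eq : P.transpose * gram n * P = - Matrix.J κ ℤ
  add_eq_one : P * (Matrix.J κ ℤ * P.transpose * gram n) + E = 1
  gram_mul : gram n * E = 0
  mul_gram : E.transpose * gram n = 0
  mul_eq_zero : E * P = 0
  fix_left : ∀ A : Gam n, A.1.1 * E = E
  fix_right : ∀ A : Gam n, E * A.1.1 = E

namespace SpFrame

variable {n : ℕ} {κ : Type} [Fintype κ] [DecidableEq κ] {P : Matrix (Fin n) (κ ⊕ κ) ℤ}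
  {E : Matrix (Fin n) (Fin n) ℤ}

/-- The matrix of coordinates with respect to a partial symplectic basis. -/
def coord (P : Matrix (Fin n) (κ ⊕ κ) ℤ) : Matrix (κ ⊕ κ) (Fin n) ℤ :=
  Matrix.J κ ℤ * P.transpose * gram n

theorem coord_mul (h : SpFrame n P E) : coord P * P = 1 := by
  rw [coord, Matrix.mul_assoc, Matrix.mul_assoc, ← Matrix.mul_assoc P.transpose, h.gram_eq, Matrix.mul_neg,
    Matrix.J_squared, neg_neg]

theorem mul_coord (h : SpFrame n P E) : P * coord P = 1 - E := eq_sub_of_add_eq h.add_eq_one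

theorem coord_mul_proj (h : SpFrame n P E) : coord P * E = 0 := by
  rw [coord, Matrix.mul_assoc, h.gram_mul, Matrix.mul_zero]

theorem proj_mul_proj (h : SpFrame n P E) : E * E = E := by
  have : E * (P * coord P) = 0 := by rw [← Matrix.mul_assoc, h.mul_eq_zero, Matrix.zero_mul]
  rw [h.mul_coord, Matrix.mul_sub, Matrix.mul_one, sub_eq_zero] at this
  exact this.symm

/-- As `E A = E` and `E P = 0`, the columns of `A P` stay in the kernel of `E`, on which `P * coord
P` is the identity. -/
theorem mul_coord_mul (h : SpFrame n P E) (A : Gam n) :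
    P * (coord P * A.1.1 * P) = A.1.1 * P := by
  rw [← Matrix.mul_assoc, ← Matrix.mul_assoc, h.mul_coord, Matrix.sub_mul, Matrix.one_mul, h.fix_right, Matrix.sub_mul,
    h.mul_eq_zero, sub_zero]

theorem mem_symplecticGroup (h : SpFrame n P E) (A : Gam n) :
    coord P * A.1.1 * P ∈ Matrix.symplecticGroup κ ℤ := by
  rw [SymplecticGroup.mem_iff', ← neg_inj]
  calc -((coord P * A.1.1 * P).transpose * Matrix.J κ ℤ * (coord P * A.1.1 * P))
      = (P * (coord P * A.1.1 * P)).transpose * gram n * (P * (coord P * A.1.1 * P)) := by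
        have e : ∀ X : Matrix (κ ⊕ κ) (κ ⊕ κ) ℤ, (P * X).transpose * gram n * (P * X) =
            X.transpose * (P.transpose * gram n * P) * X := fun X => by
          simp only [Matrix.transpose_mul, Matrix.mul_assoc]
        rw [e, h.gram_eq, Matrix.mul_neg, Matrix.neg_mul]
    _ = P.transpose * (A.1.1.transpose * gram n * A.1.1) * P := by
        rw [h.mul_coord_mul, Matrix.transpose_mul]
        simp only [Matrix.mul_assoc]
    _ = - Matrix.J κ ℤ := by rw [Gam_gram, h.gram_eq]

theorem eq_mul_add (h : SpFrame n P E) (A : Gam n) :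
    A.1.1 = P * (coord P * A.1.1 * P) * coord P + E := by
  rw [h.mul_coord_mul, Matrix.mul_assoc, h.mul_coord, Matrix.mul_sub, Matrix.mul_one, h.fix_left, sub_add_cancel]

/-- The matrix of an element of `Γ_{n-1}` with respect to a partial symplectic basis. -/
def toSp (h : SpFrame n P E) : Gam n →* Matrix.symplecticGroup κ ℤ where
  toFun A := ⟨coord P * A.1.1 * P, h.mem_symplecticGroup A⟩
  map_one' := Subtype.ext (by
    change coord P * 1 * P = 1
    rw [Matrix.mul_one, h.coord_mul])
  map_mul' A B := Subtype.ext (by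
    change coord P * (A.1.1 * B.1.1) * P = coord P * A.1.1 * P * (coord P * B.1.1 * P)
    rw [Matrix.mul_assoc (coord P * A.1.1), h.mul_coord_mul]
    simp only [Matrix.mul_assoc])

theorem toSp_val (h : SpFrame n P E) (A : Gam n) : (h.toSp A).1 = coord P * A.1.1 * P := rfl

theorem toSp_injective (h : SpFrame n P E) : Function.Injective h.toSp := by
  intro A B hAB
  refine Subtype.ext (Units.ext ?_)
  rw [h.eq_mul_add A, h.eq_mul_add B, ← h.toSp_val, ← h.toSp_val, hAB]

theorem congrOne_mul_mul {ι ι' : Type} [Fintype ι] [DecidableEq ι] {d : ℤ}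
    {X : Matrix ι ι ℤ} (hX : CongrOne d X) (U : Matrix ι' ι ℤ) (V : Matrix ι ι' ℤ) (a b : ι') :
    d ∣ (U * (X - 1) * V : Matrix ι' ι' ℤ) a b := by
  rw [Matrix.mul_apply]
  refine Finset.dvd_sum fun c _ => Dvd.dvd.mul_right ?_ _
  rw [Matrix.mul_apply]
  exact Finset.dvd_sum fun e _ => (hX e c).mul_left _

theorem mem_GamLevel_iff (h : SpFrame n P E) (d : ℤ) (A : Gam n) :
    A ∈ GamLevel n d ↔ CongrOne d (h.toSp A).1 := by
  rw [mem_GamLevel]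
  refine ⟨fun hA a b => ?_, fun hA a b => ?_⟩
  · have e : (h.toSp A).1 - 1 = coord P * (A.1.1 - 1) * P := by
      rw [Matrix.mul_sub, Matrix.sub_mul, Matrix.mul_one, h.coord_mul, h.toSp_val]
    rw [← Matrix.sub_apply, e]
    exact congrOne_mul_mul hA _ _ a b
  · have e : A.1.1 - 1 = P * ((h.toSp A).1 - 1) * coord P := by
      conv_lhs => rw [h.eq_mul_add A]
      rw [Matrix.mul_sub, Matrix.sub_mul, Matrix.mul_one, h.mul_coord, h.toSp_val]
      abel
    rw [← Matrix.sub_apply, e]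
    exact congrOne_mul_mul hA _ _ a b

theorem gram_lift (h : SpFrame n P E) (S : Matrix.symplecticGroup κ ℤ) :
    (P * S.1 * coord P + E).transpose * gram n * (P * S.1 * coord P + E) = gram n := by
  have hS := SymplecticGroup.mem_iff'.1 S.2
  have e1 : gram n * (P * S.1 * coord P + E) = gram n * (P * S.1 * coord P) := by
    rw [Matrix.mul_add, h.gram_mul, add_zero]
  rw [Matrix.mul_assoc, e1, Matrix.transpose_add, Matrix.add_mul, ← Matrix.mul_assoc E.transpose, h.mul_gram, Matrix.zero_mul,
    add_zero]
  calc (P * S.1 * coord P).transpose * (gram n * (P * S.1 * coord P))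
      = (coord P).transpose * (S.1.transpose * (P.transpose * gram n * P) * S.1) * coord P := by
        simp only [Matrix.transpose_mul, Matrix.mul_assoc]
    _ = (coord P).transpose * (P.transpose * gram n * P) * coord P := by
        rw [h.gram_eq, Matrix.mul_neg, Matrix.neg_mul, hS]
    _ = (P * coord P).transpose * (gram n * (P * coord P)) := by
        simp only [Matrix.transpose_mul, Matrix.mul_assoc]
    _ = gram n := by
        rw [h.mul_coord, Matrix.mul_sub, h.gram_mul, Matrix.transpose_sub, Matrix.sub_mul, sub_zero, Matrix.mul_one,
          h.mul_gram, Matrix.transpose_one, Matrix.one_mul, sub_zero]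

theorem lift_mul_lift (h : SpFrame n P E) {S T : Matrix (κ ⊕ κ) (κ ⊕ κ) ℤ} (hST : S * T = 1) :
    (P * S * coord P + E) * (P * T * coord P + E) = 1 := by
  have e1 : P * S * coord P * (P * T * coord P) = P * coord P := by
    calc _ = P * S * (coord P * P) * T * coord P := by simp only [Matrix.mul_assoc]
      _ = P * (S * T) * coord P := by rw [h.coord_mul, Matrix.mul_one]; simp only [Matrix.mul_assoc]
      _ = _ := by rw [hST, Matrix.mul_one]
  have e2 : P * S * coord P * E = 0 := by rw [Matrix.mul_assoc, h.coord_mul_proj, Matrix.mul_zero]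
  have e3 : E * (P * T * coord P) = 0 := by
    rw [← Matrix.mul_assoc, ← Matrix.mul_assoc, h.mul_eq_zero, Matrix.zero_mul, Matrix.zero_mul]
  rw [Matrix.add_mul, Matrix.mul_add, Matrix.mul_add, e1, e2, e3, h.proj_mul_proj, h.mul_coord]
  abel

/-- The preimage acts as `S` on the span of `P` and as the identity on the image of `E`; it
preserves the form because that image is in the radical. Whether it fixes `v_n` and `w_n` depends on
the parity of `n`. -/
theorem exists_toSp_eq (h : SpFrame n P E) (S : Matrix.symplecticGroup κ ℤ)
    (hv : (P * S.1 * coord P + E).mulVec (vVec n) = vVec n)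
    (hw : Matrix.vecMul (wVec n) (P * S.1 * coord P + E) = wVec n) : ∃ A, h.toSp A = S := by
  let A : GL (Fin n) ℤ := ⟨P * S.1 * coord P + E, P * (S⁻¹).1 * coord P + E,
    h.lift_mul_lift (congrArg Subtype.val (mul_inv_cancel S)),
    h.lift_mul_lift (congrArg Subtype.val (inv_mul_cancel S))⟩
  refine ⟨⟨A, form_mulVec_of_gram (h.gram_lift S), hv, hw⟩, Subtype.ext ?_⟩
  rw [toSp_val]
  change coord P * (P * S.1 * coord P + E) * P = S.1
  rw [Matrix.mul_add, h.coord_mul_proj, add_zero, ← Matrix.mul_assoc, ← Matrix.mul_assoc, h.coord_mul, Matrix.one_mul,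
    Matrix.mul_assoc, h.coord_mul, Matrix.mul_one]

end SpFrame

/-- The vector `e_1 + ⋯ + e_m`, truncated to length `n`. -/
def initVec (n m : ℕ) : Fin n → ℤ := fun a => if (a : ℕ) < m then 1 else 0

/-- The vector with the entries `1` in the positions `m + 1` and `m + 2`, truncated to length `n`;
positions start at `0`. -/
def pairVec (n m : ℕ) : Fin n → ℤ := fun a =>
  (if (a : ℕ) = m + 1 then 1 else 0) + if (a : ℕ) = m + 2 then 1 else 0

/-- The vectors of a symplectic basis of `ℤⁿ` for `n = 2g`, and of `w_n^⊥` for `n = 2g + 1`. -/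
def spBasis (n g : ℕ) : Matrix (Fin n) (Fin g ⊕ Fin g) ℤ := Matrix.of fun a =>
  Sum.elim (fun i => initVec n (2 * (i.rev : ℕ) + 2) a) fun i => pairVec n (2 * (i.rev : ℕ)) a

/-! ### The Gram matrix of the explicit symplectic basis -/

theorem initVec_succ {n m : ℕ} (hm : 2 * (m + 1) ≤ n) :
    initVec n (2 * (m + 1)) = initVec n (2 * m) + colVec ⟨2 * m, by omega⟩ := by
  ext a
  simp only [initVec, colVec, lo, hi, Pi.add_apply, Pi.single_apply, Fin.ext_iff]
  split_ifs <;> omega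

/-- An initial vector of even length is a sum of disjoint vectors `colVec`, each of which the Gram
matrix turns into the `rowVec` with the same support. -/
theorem gram_mulVec_initVec {n : ℕ} (m : ℕ) (hm : 2 * m ≤ n) :
    (gram n).mulVec (initVec n (2 * m)) = fun a : Fin n => (-1) ^ (a : ℕ) * initVec n (2 * m) a := by
  induction m with
  | zero =>
    ext a
    simp [initVec, Matrix.mulVec, dotProduct]
  | succ m ih =>
    rw [initVec_succ hm, Matrix.mulVec_add, ih (by omega), gram_mulVec_col]
    ext a
    simp only [rowVec, colVec, lo, hi, Pi.add_apply, Pi.sub_apply, Pi.single_apply, Fin.ext_iff]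
    rw [mul_add, add_right_inj]
    split_ifs with h1 h2 h2
    · omega
    · simp [h1, pow_mul]
    · simp [h2, pow_succ, pow_mul]
    · simp

theorem form_initVec {n : ℕ} (x : Fin n → ℤ) (m : ℕ) (hm : 2 * m ≤ n) :
    form x (initVec n (2 * m)) = ∑ a : Fin n, (-1) ^ (a : ℕ) * x a * initVec n (2 * m) a := by
  rw [form, gram_mulVec_initVec m hm, dotProduct]
  exact Finset.sum_congr rfl fun a _ => by ring

theorem form_self {n : ℕ} (x : Fin n → ℤ) : form x x = 0 := by
  have := form_antisymm x x
  omega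

theorem form_initVec_initVec {n : ℕ} (k m : ℕ) (hk : 2 * k ≤ n) (hm : 2 * m ≤ n) :
    form (initVec n (2 * k)) (initVec n (2 * m)) = 0 := by
  wlog hkm : k ≤ m generalizing k m
  · rw [form_antisymm, this m k hm hk (by omega), neg_zero]
  rw [form_initVec _ _ hm]
  have e : ∀ a : Fin n, (-1 : ℤ) ^ (a : ℕ) * initVec n (2 * k) a * initVec n (2 * m) a =
      (fun b : ℕ => if b < 2 * k then (-1 : ℤ) ^ b else 0) a := by
    intro a
    simp only [initVec]
    split_ifs <;> omega
  rw [Finset.sum_congr rfl fun a _ => e a,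
    Fin.sum_univ_eq_sum_range (fun b : ℕ => if b < 2 * k then (-1 : ℤ) ^ b else 0),
    ← Finset.sum_filter]
  have : (Finset.range n).filter (· < 2 * k) = Finset.range (2 * k) := by
    ext b
    simp only [Finset.mem_filter, Finset.mem_range]
    omega
  rw [this, neg_one_geom_sum, if_pos (even_two_mul k)]

theorem form_pairVec_initVec {n : ℕ} (k m : ℕ) (hk : 2 * k + 2 ≤ n) (hm : 2 * m + 2 ≤ n) :
    form (pairVec n (2 * k)) (initVec n (2 * m + 2)) = if k = m then -1 else 0 := by
  rw [show 2 * m + 2 = 2 * (m + 1) by ring, form_initVec _ _ (by omega)]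
  have e : ∀ a : Fin n,
      (-1 : ℤ) ^ (a : ℕ) * pairVec n (2 * k) a * initVec n (2 * (m + 1)) a =
      (fun b : ℕ => (if b = 2 * k + 1 then (if k ≤ m then -1 else 0) else 0) +
        (if b = 2 * k + 2 then (if k < m then (1 : ℤ) else 0) else 0)) a := by
    intro a
    simp only [initVec, pairVec]
    by_cases h1 : (a : ℕ) = 2 * k + 1
    · by_cases h3 : k ≤ m
      · simp [h1, h3, pow_succ, pow_mul, show 2 * k + 1 < 2 * (m + 1) by omega]
      · simp [h1, h3, show ¬ 2 * k + 1 < 2 * (m + 1) by omega]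
    · by_cases h2 : (a : ℕ) = 2 * k + 2
      · by_cases h3 : k < m
        · simp [h2, h3, pow_succ, pow_mul, show 2 * k + 2 < 2 * (m + 1) by omega]
        · simp [h2, h3, show ¬ 2 * k + 2 < 2 * (m + 1) by omega]
      · simp [h1, h2]
  rw [Finset.sum_congr rfl fun a _ => e a,
    Fin.sum_univ_eq_sum_range (fun b : ℕ => (if b = 2 * k + 1 then (if k ≤ m then -1 else 0) else 0)
      + (if b = 2 * k + 2 then (if k < m then (1 : ℤ) else 0) else 0)),
    Finset.sum_add_distrib, Finset.sum_ite_eq', Finset.sum_ite_eq']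
  simp only [Finset.mem_range]
  split_ifs <;> omega

theorem form_pairVec_pairVec {n : ℕ} (k m : ℕ) (hk : 2 * k + 2 ≤ n) (hm : 2 * m + 2 ≤ n) :
    form (pairVec n (2 * k)) (pairVec n (2 * m)) = 0 := by
  wlog hkm : m ≤ k generalizing k m
  · rw [form_antisymm, this m k hm hk (by omega), neg_zero]
  rcases hkm.eq_or_lt with rfl | h
  · exact form_self _
  -- Truncation can affect only the last pair, so for `m < k` the pair of `m` is a full `colVec`.
  have e : pairVec n (2 * m) = colVec ⟨2 * m + 1, by omega⟩ := by
    ext a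
    simp [pairVec, colVec, lo, hi, Pi.single_apply, Fin.ext_iff]
  rw [form, e, gram_mulVec_col, rowVec, dotProduct_sub, dotProduct_single, dotProduct_single]
  simp only [pairVec, lo, hi]
  split_ifs <;> omega

theorem transpose_mul_gram_mul_apply {n : ℕ} {κ : Type} (P : Matrix (Fin n) κ ℤ) (x y : κ) :
    (P.transpose * gram n * P) x y = form (fun a => P a x) (fun a => P a y) := by
  rw [form, Matrix.mul_assoc, Matrix.mul_apply]
  rfl

theorem spBasis_gram {n g : ℕ} (hg : 2 * g ≤ n) :
    (spBasis n g).transpose * gram n * spBasis n g = - Matrix.J (Fin g) ℤ := by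
  have hb : ∀ i : Fin g, 2 * (i.rev : ℕ) + 2 ≤ n := fun i => by omega
  have hab : ∀ i j : Fin g, (i.rev : ℕ) = (j.rev : ℕ) ↔ i = j := fun i j => by
    rw [← Fin.ext_iff, Fin.rev_inj]
  ext x y
  rw [transpose_mul_gram_mul_apply]
  rcases x with i | i <;> rcases y with j | j
  · refine (form_initVec_initVec (n := n) (i.rev + 1) (j.rev + 1)
      (by have := hb i; omega) (by have := hb j; omega)).trans ?_
    simp [Matrix.J]
  · have := form_pairVec_initVec (n := n) j.rev i.rev (hb j) (hb i)
    simp only [hab] at this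
    rw [form_antisymm]
    refine (congrArg Neg.neg this).trans ?_
    rcases eq_or_ne j i with rfl | h
    · simp [Matrix.J]
    · simp [Matrix.J, h, h.symm]
  · have := form_pairVec_initVec (n := n) i.rev j.rev (hb i) (hb j)
    simp only [hab] at this
    refine this.trans ?_
    rcases eq_or_ne i j with rfl | h
    · simp [Matrix.J]
    · simp [Matrix.J, h]
  · refine (form_pairVec_pairVec (n := n) i.rev j.rev (hb i) (hb j)).trans ?_
    simp [Matrix.J]

/-! ### The symplectic frames for even and odd `n` -/

theorem coord_mul_of_gram {n : ℕ} {κ : Type} [Fintype κ] [DecidableEq κ]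
    {P : Matrix (Fin n) (κ ⊕ κ) ℤ} (h : P.transpose * gram n * P = - Matrix.J κ ℤ) :
    Matrix.J κ ℤ * P.transpose * gram n * P = 1 := by
  rw [Matrix.mul_assoc, Matrix.mul_assoc, ← Matrix.mul_assoc P.transpose, h, Matrix.mul_neg, Matrix.J_squared, neg_neg]

theorem gram_mulVec_vVec_even (g : ℕ) : (gram (2 * g)).mulVec (vVec (2 * g)) = wVec (2 * g) := by
  have e : vVec (2 * g) = initVec (2 * g) (2 * g) := by
    ext a
    simp [vVec, initVec]
  rw [e, gram_mulVec_initVec g le_rfl]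
  ext a
  simp [initVec, wVec]

theorem gram_mulVec_vVec_odd (g : ℕ) : (gram (2 * g + 1)).mulVec (vVec (2 * g + 1)) = 0 := by
  have e : vVec (2 * g + 1) = initVec (2 * g + 1) (2 * g) + Pi.single (Fin.last _) 1 := by
    ext a
    simp only [vVec, initVec, Pi.add_apply, Pi.single_apply, Fin.ext_iff, Fin.val_last]
    split_ifs <;> omega
  rw [e, Matrix.mulVec_add, gram_mulVec_initVec g (by omega), Matrix.mulVec_single_one]
  ext a
  rw [Pi.add_apply, Matrix.col_apply, gram_castSucc_last, initVec]
  rcases (Fin.le_last a).eq_or_lt with rfl | h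
  · simp
  · have h' : (a : ℕ) < 2 * g := h
    simp [h', h.ne, pow_succ, pow_mul]

theorem spFrame_even (g : ℕ) : SpFrame (2 * g) (spBasis (2 * g) g) 0 where
  gram_eq := spBasis_gram le_rfl
  add_eq_one := by
    rw [add_zero, Matrix.mul_eq_one_comm_of_equiv (Fintype.equivOfCardEq (by simp; ring))]
    exact coord_mul_of_gram (spBasis_gram le_rfl)
  gram_mul := Matrix.mul_zero _
  mul_gram := by simp
  mul_eq_zero := Matrix.zero_mul _
  fix_left _ := Matrix.mul_zero _
  fix_right _ := Matrix.zero_mul _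

theorem wVec_dot_initVec {n : ℕ} (m : ℕ) (hm : 2 * m ≤ n) : wVec n ⬝ᵥ initVec n (2 * m) = 0 := by
  induction m with
  | zero => simp [initVec, dotProduct]
  | succ m ih =>
    rw [initVec_succ hm, dotProduct_add, ih (by omega), colVec, dotProduct_add, dotProduct_single,
      dotProduct_single]
    simp [wVec, lo, hi, pow_succ]

theorem wVec_vecMul_spBasis (g : ℕ) :
    Matrix.vecMul (wVec (2 * g + 1)) (spBasis (2 * g + 1) g) = 0 := by
  ext x
  rcases x with i | i
  · exact wVec_dot_initVec (n := 2 * g + 1) (i.rev + 1) (by omega)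
  · have e : pairVec (2 * g + 1) (2 * (i.rev : ℕ)) =
        colVec ⟨2 * (i.rev : ℕ) + 1, by omega⟩ := by
      ext a
      simp [pairVec, colVec, lo, hi, Pi.single_apply, Fin.ext_iff]
    change wVec _ ⬝ᵥ pairVec (2 * g + 1) (2 * (i.rev : ℕ)) = 0
    rw [e, colVec, dotProduct_add, dotProduct_single, dotProduct_single]
    simp [wVec, lo, hi, pow_succ]

theorem wVec_dot_vVec_odd (g : ℕ) : wVec (2 * g + 1) ⬝ᵥ vVec (2 * g + 1) = 1 := by
  simp only [dotProduct, wVec, vVec, mul_one]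
  rw [Fin.sum_univ_eq_sum_range (fun a => (-1 : ℤ) ^ a), neg_one_geom_sum, if_neg (by simp)]

theorem vVec_vecMul_gram_odd (g : ℕ) : Matrix.vecMul (vVec (2 * g + 1)) (gram (2 * g + 1)) = 0 := by
  ext a
  have := form_antisymm (vVec (2 * g + 1)) (Pi.single a 1)
  rw [form, form, gram_mulVec_vVec_odd, dotProduct_zero, neg_zero, Matrix.dotProduct_mulVec,
    dotProduct_single_one] at this
  exact this

theorem spFrame_odd (g : ℕ) : SpFrame (2 * g + 1) (spBasis (2 * g + 1) g)
    (Matrix.vecMulVec (vVec (2 * g + 1)) (wVec (2 * g + 1))) where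
  gram_eq := spBasis_gram (by omega)
  add_eq_one := by
    set Q := Matrix.J (Fin g) ℤ * (spBasis (2 * g + 1) g).transpose * gram (2 * g + 1) with hQ
    have hQP : Q * spBasis (2 * g + 1) g = 1 := coord_mul_of_gram (spBasis_gram (by omega))
    -- Adjoining `v_n` as a column to `P` and `w_n` as a row to `Q` gives square matrices. Their
    -- product in one order is `1` by the pairings, and the other order is the required identity.
    have e := (Matrix.fromCols_mul_fromRows_eq_one_comm
      (Fintype.equivOfCardEq (by simp; ring) : Fin (2 * g + 1) ≃ (Fin g ⊕ Fin g) ⊕ Unit)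
      (spBasis (2 * g + 1) g) (Matrix.replicateCol Unit (vVec (2 * g + 1))) Q
      (Matrix.replicateRow Unit (wVec (2 * g + 1)))).2 ?_
    · rw [Matrix.fromCols_mul_fromRows] at e
      rw [Matrix.vecMulVec_eq Unit]
      exact e
    · rw [Matrix.fromRows_mul_fromCols, hQP, ← Matrix.replicateCol_mulVec,
        ← Matrix.replicateRow_vecMul, wVec_vecMul_spBasis, hQ, ← Matrix.mulVec_mulVec,
        gram_mulVec_vVec_odd, Matrix.mulVec_zero]
      ext x y
      rcases x with x | x <;> rcases y with y | y
      · simp [Matrix.one_apply]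
      · simp
      · simp
      · simpa [Matrix.mul_apply, dotProduct] using wVec_dot_vVec_odd g
  gram_mul := by rw [Matrix.mul_vecMulVec, gram_mulVec_vVec_odd, Matrix.zero_vecMulVec]
  mul_gram := by
    rw [Matrix.transpose_vecMulVec, Matrix.vecMulVec_mul, vVec_vecMul_gram_odd,
      Matrix.vecMulVec_zero]
  mul_eq_zero := by
    rw [Matrix.vecMulVec_mul, wVec_vecMul_spBasis]
    ext
    simp [Matrix.vecMulVec_apply]
  fix_left A := by rw [Matrix.mul_vecMulVec, A.2.2.1]
  fix_right A := by rw [Matrix.vecMulVec_mul, A.2.2.2]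

theorem exists_mulEquiv_symplecticGroup (g : ℕ) :
    ∃ φ : Gam (2 * g + 1) ≃* Matrix.symplecticGroup (Fin g) ℤ,
      ∀ (d : ℤ) (A : Gam (2 * g + 1)), A ∈ GamLevel (2 * g + 1) d ↔ CongrOne d (φ A).1 := by
  have h := spFrame_odd g
  have hsurj : Function.Surjective h.toSp := by
    intro S
    refine h.exists_toSp_eq S ?_ ?_
    · rw [Matrix.add_mulVec, SpFrame.coord, ← Matrix.mulVec_mulVec, ← Matrix.mulVec_mulVec,
        ← Matrix.mulVec_mulVec, gram_mulVec_vVec_odd, Matrix.mulVec_zero, Matrix.mulVec_zero, Matrix.mulVec_zero, zero_add,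
        Matrix.vecMulVec_mulVec, wVec_dot_vVec_odd]
      simp
    · rw [Matrix.vecMul_add, ← Matrix.vecMul_vecMul, ← Matrix.vecMul_vecMul, wVec_vecMul_spBasis,
        Matrix.zero_vecMul, Matrix.zero_vecMul, zero_add, Matrix.vecMul_vecMulVec,
        wVec_dot_vVec_odd, one_smul]
  exact ⟨MulEquiv.ofBijective h.toSp ⟨h.toSp_injective, hsurj⟩, h.mem_GamLevel_iff⟩

/-- This is why `spBasis` reverses its indices: the longest initial vector, `v_n`, has to come
first. -/
theorem spBasis_mulVec_e₁ (g : ℕ) :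
    (spBasis (2 * (g + 1)) (g + 1)).mulVec (e₁ g) = vVec (2 * (g + 1)) := by
  rw [e₁, Matrix.mulVec_single_one]
  ext a
  simp [spBasis, initVec, vVec]
  omega

theorem exists_mulEquiv_spStab (g : ℕ) :
    ∃ φ : Gam (2 * (g + 1)) ≃* spStab g, ∀ (d : ℤ) (A : Gam (2 * (g + 1))),
      A ∈ GamLevel (2 * (g + 1)) d ↔ CongrOne d (φ A).1.1 := by
  have h := spFrame_even (g + 1)
  have hQv : (SpFrame.coord (spBasis (2 * (g + 1)) (g + 1))).mulVec (vVec (2 * (g + 1))) =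
      e₁ g := by
    rw [← spBasis_mulVec_e₁, Matrix.mulVec_mulVec, h.coord_mul, Matrix.one_mulVec]
  have hrange : h.toSp.range = spStab g := by
    ext S
    constructor
    · rintro ⟨A, rfl⟩
      change (SpFrame.coord (spBasis (2 * (g + 1)) (g + 1)) * A.1.1 *
        spBasis (2 * (g + 1)) (g + 1)).mulVec (e₁ g) = e₁ g
      rw [← Matrix.mulVec_mulVec, spBasis_mulVec_e₁, ← Matrix.mulVec_mulVec, A.2.2.1, hQv]
    · intro hS
      have hv : (spBasis (2 * (g + 1)) (g + 1) * S.1 *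
          SpFrame.coord (spBasis (2 * (g + 1)) (g + 1)) + 0).mulVec (vVec (2 * (g + 1))) =
          vVec (2 * (g + 1)) := by
        rw [add_zero, ← Matrix.mulVec_mulVec, hQv, ← Matrix.mulVec_mulVec,
          show S.1.mulVec (e₁ g) = e₁ g from hS, spBasis_mulVec_e₁]
      refine h.exists_toSp_eq S hv ?_
      have hG := h.gram_lift S
      set A := spBasis (2 * (g + 1)) (g + 1) * S.1 *
          SpFrame.coord (spBasis (2 * (g + 1)) (g + 1)) + 0
      -- Since `w_n` is the Gram matrix applied to `v_n`, its invariance follows from that of `v_n`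
      -- and of the form.
      rw [← Matrix.mulVec_transpose, ← gram_mulVec_vVec_even]
      conv_lhs => rw [← hv]
      rw [Matrix.mulVec_mulVec, Matrix.mulVec_mulVec, hG]
  exact ⟨(MonoidHom.ofInjective h.toSp_injective).trans (MulEquiv.subgroupCongr hrange),
    h.mem_GamLevel_iff⟩

/-! ### Quotients of the braid group -/

/-- An isomorphism `G / K ≃ H` induced by a surjection `G → H` with kernel `K`. -/
theorem exists_quotient_mulEquiv {G H : Type*} [Group G] [Group H] {K : Subgroup G} [K.Normal]
    (f : G →* H) (hf : Function.Surjective f) (hK : ∀ x, x ∈ K ↔ f x = 1) :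
    ∃ e : G ⧸ K ≃* H, ∀ x : G, e (QuotientGroup.mk x) = f x := by
  obtain rfl : K = f.ker := Subgroup.ext fun x => hK x
  exact ⟨QuotientGroup.quotientKerEquivOfSurjective f hf, fun _ => rfl⟩

/-- The map from the braid group to the quotient `Γ_{n-1}/Γ_{n-1}[d]`. -/
def burauQuot (n : ℕ) (d : ℤ) : Braid n →* Gam n ⧸ GamLevel n d :=
  (QuotientGroup.mk' (GamLevel n d)).comp (burau n)

theorem burauQuot_eq_one {n : ℕ} {d : ℤ} {b : Braid n} :
    burauQuot n d b = 1 ↔ b ∈ BraidLevel n d :=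
  QuotientGroup.eq_one_iff _

theorem isUnit_two_of_odd {R : Type*} [CommRing R] {d : ℤ} (hd : Odd d) (h : (d : R) = 0) :
    IsUnit (2 : R) := by
  obtain ⟨r, rfl⟩ := hd
  push_cast at h
  exact IsUnit.of_mul_eq_one (-(r : R)) (by linear_combination -h)

theorem burauQuot_surjective {n : ℕ} {d : ℤ} (h : n ≤ 3 ∨ Odd d) :
    Function.Surjective (burauQuot n d) := by
  intro x
  obtain ⟨A, rfl⟩ := QuotientGroup.mk_surjective x
  let R := ℤ ⧸ Ideal.span {d}
  have hcast : Int.castRingHom R = Ideal.Quotient.mk (Ideal.span {d}) := RingHom.ext_int _ _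
  have hs : Function.Surjective (Int.castRingHom R) := by
    rw [hcast]
    exact Ideal.Quotient.mk_surjective
  have hR : ∀ z : ℤ, (z : R) = 0 ↔ d ∣ z := by
    intro z
    rw [← Ideal.mem_span_singleton, ← Ideal.Quotient.eq_zero_iff_mem, ← hcast, eq_intCast]
  have h2 : n ≤ 3 ∨ IsUnit (2 : R) := by
    refine h.imp id fun hd => ?_
    exact isUnit_two_of_odd hd ((hR d).2 dvd_rfl)
  obtain ⟨b, hb⟩ := exists_burauMod_eq hs n h2 (isGam_map (R := R) A)
  refine ⟨b, (QuotientGroup.eq).2 (inv_mul_mem_GamLevel fun a c => ?_)⟩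
  have := congrFun (congrFun hb a) c
  rw [← hR, Int.cast_sub, sub_eq_zero]
  exact this.symm

theorem exists_braidQuot_equiv {n : ℕ} {d : ℤ} (h : n ≤ 3 ∨ Odd d) :
    ∃ e : Braid n ⧸ BraidLevel n d ≃* Gam n ⧸ GamLevel n d,
      ∀ b : Braid n, e (QuotientGroup.mk b) = QuotientGroup.mk (burau n b) :=
  exists_quotient_mulEquiv (burauQuot n d) (burauQuot_surjective h)
    fun _ => burauQuot_eq_one.symm

/-! ### Splitting off the odd part of the level -/

theorem sigma_zpow_mem_BraidLevel {n : ℕ} (i : Fin (n - 1)) {d z : ℤ} (h : d ∣ z) :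
    sigma i ^ z ∈ BraidLevel n d := by
  rw [mem_BraidLevel, mem_GamLevel]
  intro a b
  rw [burau_sigma_zpow, Matrix.add_apply, add_sub_cancel_left, Matrix.smul_apply, smul_eq_mul]
  exact h.mul_right _

theorem BraidLevel_sup_eq_top {n : ℕ} {c d : ℤ} (h : IsCoprime c d) :
    BraidLevel n c ⊔ BraidLevel n d = ⊤ := by
  rw [eq_top_iff]
  intro b _
  refine PresentedGroup.generated_by _ _ (fun i => ?_) b
  obtain ⟨x, y, hxy⟩ := h
  have e : (PresentedGroup.of i : Braid n) = sigma i ^ (x * c) * sigma i ^ (y * d) := by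
    rw [← zpow_add, hxy, zpow_one]
    rfl
  rw [e]
  exact Subgroup.mul_mem_sup (sigma_zpow_mem_BraidLevel i (dvd_mul_left _ _))
    (sigma_zpow_mem_BraidLevel i (dvd_mul_left _ _))

theorem mem_BraidLevel_mul {n : ℕ} {c d : ℤ} (h : IsCoprime c d) {b : Braid n} :
    b ∈ BraidLevel n (c * d) ↔ b ∈ BraidLevel n c ∧ b ∈ BraidLevel n d := by
  simp only [mem_BraidLevel, mem_GamLevel]
  exact ⟨fun hb => ⟨fun x y => (dvd_mul_right _ _).trans (hb x y),
    fun x y => (dvd_mul_left _ _).trans (hb x y)⟩,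
    fun hb x y => h.mul_dvd (hb.1 x y) (hb.2 x y)⟩

theorem exists_braidQuot_equiv_prod {n : ℕ} {c m : ℤ} (hm : Odd m) (h : IsCoprime c m) :
    ∃ e : Braid n ⧸ BraidLevel n (c * m) ≃* (Braid n ⧸ BraidLevel n c) × (Gam n ⧸ GamLevel n m),
      ∀ b : Braid n, e (QuotientGroup.mk b) = (QuotientGroup.mk b, QuotientGroup.mk (burau n b)) := by
  have hsurj : Function.Surjective (burauQuot n m) := burauQuot_surjective (Or.inr hm)
  refine exists_quotient_mulEquiv ((QuotientGroup.mk' (BraidLevel n c)).prod (burauQuot n m))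
    ?_ fun b => ?_
  · rintro ⟨x, y⟩
    obtain ⟨b, rfl⟩ := QuotientGroup.mk_surjective x
    obtain ⟨b', rfl⟩ := hsurj y
    have hmem : b⁻¹ * b' ∈ BraidLevel n c ⊔ BraidLevel n m := by
      rw [BraidLevel_sup_eq_top h]
      trivial
    -- From `b⁻¹ * b' = p * q`, the braid `b * p = b' * q⁻¹` agrees with `b` modulo `B_n[c]` and
    -- with `b'` modulo `B_n[m]`.
    obtain ⟨p, hp, q, hq, hpq⟩ := Subgroup.mem_sup_of_normal_right.1 hmem
    refine ⟨b * p, Prod.ext ?_ ?_⟩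
    · refine (QuotientGroup.eq.2 ?_ : (QuotientGroup.mk (b * p) : Braid n ⧸ BraidLevel n c) = _)
      simpa using hp
    · change burauQuot n m (b * p) = burauQuot n m b'
      have e : b' = b * p * q := by rw [mul_assoc, hpq, mul_inv_cancel_left]
      rw [e, map_mul _ _ q, burauQuot_eq_one.2 hq, mul_one]
  · rw [MonoidHom.prod_apply, Prod.mk_eq_one, mem_BraidLevel_mul h, burauQuot_eq_one,
      QuotientGroup.mk'_apply, QuotientGroup.eq_one_iff]

/-! ### The quotients at powers of `2` -/

theorem subsingleton_braidQuot_one (n : ℕ) : Subsingleton (Braid n ⧸ BraidLevel n 1) := by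
  rw [QuotientGroup.subsingleton_iff, eq_top_iff]
  intro b _
  rw [mem_BraidLevel, mem_GamLevel]
  exact fun _ _ => one_dvd _

theorem exists_braidQuot_two_equiv (n : ℕ) :
    ∃ e : Braid n ⧸ BraidLevel n 2 ≃* Equiv.Perm (Fin n),
      ∀ i : Fin (n - 1), e (QuotientGroup.mk (sigma i)) = Equiv.swap (lo i) (hi i) := by
  obtain ⟨e, he⟩ := exists_quotient_mulEquiv (K := BraidLevel n 2) (permutation n)
    (permutation_surjective n) fun b => mem_BraidLevel.trans mem_GamLevel_two
  exact ⟨e, fun i => by rw [he, permutation_sigma]⟩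

/-- Both groups are quotients of `B_n` by the same kernel `B_n[2]`. -/
theorem exists_perm_equiv_symImage (n : ℕ) : ∃ ι : Equiv.Perm (Fin n) ≃* symImage n,
    ∀ b : Braid n, (ι (permutation n b) : Gam n ⧸ GamLevel n 2) =
      QuotientGroup.mk (burau n b) := by
  obtain ⟨e, he⟩ := exists_quotient_mulEquiv (K := BraidLevel n 2) (permutation n)
    (permutation_surjective n) fun b => mem_BraidLevel.trans mem_GamLevel_two
  obtain ⟨e', he'⟩ := exists_quotient_mulEquiv (K := BraidLevel n 2)
    ((burauQuot n 2).codRestrict (symImage n) fun b => ⟨b, rfl⟩)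
    (by
      rintro ⟨_, b, rfl⟩
      exact ⟨b, rfl⟩)
    (fun b => by
      rw [← burauQuot_eq_one, ← Subtype.val_injective.eq_iff]
      rfl)
  refine ⟨e.symm.trans e', fun b => ?_⟩
  rw [← he, MulEquiv.trans_apply, MulEquiv.symm_apply_apply]
  exact congrArg Subtype.val (he' b)

theorem GamProj_mk {n : ℕ} {d l : ℤ} (h : d ∣ l) (A : Gam n) :
    GamProj n h (QuotientGroup.mk A) = QuotientGroup.mk A := rfl

theorem burauQuot_mem_symPreimage {n : ℕ} {l : ℤ} (h : 2 ∣ l) (b : Braid n) :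
    burauQuot n l b ∈ symPreimage n h := ⟨b, rfl⟩

/-- A representative of `x` differs from some `ρ(b)` by an element of `Γ_{n-1}[2]`, which is itself
the image of a braid modulo `2^k`. -/
theorem exists_burauQuot_eq_of_mem_symPreimage {n k : ℕ} (hk : 2 ≤ k)
    {x : Gam n ⧸ GamLevel n (2 ^ k)} (hx : x ∈ symPreimage n (two_dvd_two_pow hk)) :
    ∃ b, burauQuot n (2 ^ k) b = x := by
  obtain ⟨A, rfl⟩ := QuotientGroup.mk_surjective x
  obtain ⟨b, hb⟩ := hx
  have hb' : (burau n b)⁻¹ * A ∈ GamLevel n 2 := QuotientGroup.eq.1 hb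
  obtain ⟨b', hb''⟩ := exists_mem_GamLevel_two_pow (k := k) (by omega) hb'
  refine ⟨b * b', QuotientGroup.eq.2 ?_⟩
  rwa [map_mul, mul_inv_rev, mul_assoc]

theorem exists_braidQuot_equiv_symPreimage {n k : ℕ} (hk : 2 ≤ k) :
    ∃ e : Braid n ⧸ BraidLevel n (2 ^ k) ≃* symPreimage n (two_dvd_two_pow hk),
      ∀ b : Braid n, (e (QuotientGroup.mk b) : Gam n ⧸ GamLevel n (2 ^ k)) =
        QuotientGroup.mk (burau n b) := by
  obtain ⟨e, he⟩ := exists_quotient_mulEquiv (K := BraidLevel n (2 ^ k))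
    ((burauQuot n (2 ^ k)).codRestrict (symPreimage n (two_dvd_two_pow hk))
      (burauQuot_mem_symPreimage _))
    (by
      rintro ⟨x, hx⟩
      obtain ⟨b, rfl⟩ := exists_burauQuot_eq_of_mem_symPreimage hk hx
      exact ⟨b, rfl⟩)
    (fun b => by
      rw [← burauQuot_eq_one, ← Subtype.val_injective.eq_iff]
      rfl)
  exact ⟨e, fun b => congrArg Subtype.val (he b)⟩

theorem mk_mem_symPreimage {n : ℕ} {l : ℤ} (h : 2 ∣ l) {A : Gam n} (hA : A ∈ GamLevel n 2) :
    (QuotientGroup.mk A : Gam n ⧸ GamLevel n l) ∈ symPreimage n h := by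
  rw [symPreimage, Subgroup.mem_comap, GamProj_mk, (QuotientGroup.eq_one_iff A).2 hA]
  exact one_mem _

/-- The map `Γ_{n-1}[2] → X`. -/
def levelTwoHom (n : ℕ) {l : ℤ} (h : 2 ∣ l) : GamLevel n 2 →* symPreimage n h where
  toFun A := ⟨QuotientGroup.mk A.1, mk_mem_symPreimage h A.2⟩
  map_one' := rfl
  map_mul' _ _ := rfl

theorem levelTwoHom_eq_one {n : ℕ} {l : ℤ} (h : 2 ∣ l) (A : GamLevel n 2) :
    levelTwoHom n h A = 1 ↔ A ∈ (GamLevel n l).subgroupOf (GamLevel n 2) := by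
  rw [Subgroup.mem_subgroupOf, ← QuotientGroup.eq_one_iff, Subtype.ext_iff]
  exact Iff.rfl

/-- The inclusion `Γ_{n-1}[2]/Γ_{n-1}[ℓ] → X`. -/
def levelQuotInl (n : ℕ) {l : ℤ} (h : 2 ∣ l) : LevelQuot n l →* symPreimage n h :=
  QuotientGroup.lift _ (levelTwoHom n h) fun A hA => (levelTwoHom_eq_one h A).2 hA

theorem levelQuotInl_mk {n : ℕ} {l : ℤ} (h : 2 ∣ l) (A : GamLevel n 2) :
    levelQuotInl n h (QuotientGroup.mk A) = levelTwoHom n h A := rfl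

theorem levelQuotInl_injective {n : ℕ} {l : ℤ} (h : 2 ∣ l) :
    Function.Injective (levelQuotInl n h) := by
  rw [injective_iff_map_eq_one]
  intro x hx
  obtain ⟨A, rfl⟩ := QuotientGroup.mk_surjective x
  rw [levelQuotInl_mk, levelTwoHom_eq_one] at hx
  exact (QuotientGroup.eq_one_iff _).2 hx

/-- The quotient map `X → S_n`, for an identification of `S_n` with its image in
`Γ_{n-1}/Γ_{n-1}[2]`. -/
def symProj {n : ℕ} (ι : Equiv.Perm (Fin n) ≃* symImage n) {l : ℤ} (h : 2 ∣ l) :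
    symPreimage n h →* Equiv.Perm (Fin n) :=
  ι.symm.toMonoidHom.comp ((GamProj n h).subgroupComap (symImage n))

theorem symProj_spec {n : ℕ} (ι : Equiv.Perm (Fin n) ≃* symImage n) {l : ℤ} (h : 2 ∣ l)
    (x : symPreimage n h) : (ι (symProj ι h x) : Gam n ⧸ GamLevel n 2) = GamProj n h x := by
  change ((ι (ι.symm ((GamProj n h).subgroupComap (symImage n) x)) : symImage n) :
    Gam n ⧸ GamLevel n 2) = _
  rw [MulEquiv.apply_symm_apply]
  rfl

theorem symProj_eq_one {n : ℕ} (ι : Equiv.Perm (Fin n) ≃* symImage n) {l : ℤ} (h : 2 ∣ l)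
    (x : symPreimage n h) :
    symProj ι h x = 1 ↔ GamProj n h (x : Gam n ⧸ GamLevel n l) = 1 := by
  rw [← symProj_spec ι h x, ← map_eq_one_iff ι ι.injective, OneMemClass.coe_eq_one]

/-- The extension `1 → Γ_{n-1}[2]/Γ_{n-1}[ℓ] → X → S_n → 1`. -/
def levelExtension {n : ℕ} (ι : Equiv.Perm (Fin n) ≃* symImage n) {l : ℤ} (h : 2 ∣ l) :
    GroupExtension (LevelQuot n l) (symPreimage n h) (Equiv.Perm (Fin n)) where
  inl := levelQuotInl n h
  rightHom := symProj ι h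
  inl_injective := levelQuotInl_injective h
  range_inl_eq_ker_rightHom := by
    ext x
    rw [MonoidHom.mem_ker, symProj_eq_one]
    constructor
    · rintro ⟨y, rfl⟩
      obtain ⟨A, rfl⟩ := QuotientGroup.mk_surjective y
      exact (QuotientGroup.eq_one_iff A.1).2 A.2
    · intro hx
      obtain ⟨x, hx'⟩ := x
      obtain ⟨A, rfl⟩ := QuotientGroup.mk_surjective x
      exact ⟨QuotientGroup.mk ⟨A, (QuotientGroup.eq_one_iff A).1 hx⟩, rfl⟩
  rightHom_surjective := by
    intro τ
    obtain ⟨b, hb⟩ := (ι τ).2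
    refine ⟨⟨burauQuot n l b, burauQuot_mem_symPreimage h b⟩, ι.injective (Subtype.ext ?_)⟩
    rw [symProj_spec]
    exact hb

/-- A splitting would send a transposition to an involution; as `4 ∣ 2^k`, this contradicts
`mul_self_notMem_GamLevel_four`. -/
theorem isEmpty_splitting {n k : ℕ} (hn : 2 ≤ n) (hk : 2 ≤ k)
    (ι : Equiv.Perm (Fin n) ≃* symImage n)
    (hι : ∀ b : Braid n, (ι (permutation n b) : Gam n ⧸ GamLevel n 2) =
      QuotientGroup.mk (burau n b)) :
    IsEmpty (levelExtension ι (two_dvd_two_pow hk)).Splitting := by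
  refine ⟨fun s => ?_⟩
  let i : Fin (n - 1) := ⟨0, by omega⟩
  set τ := Equiv.swap (lo i) (hi i) with hτ
  obtain ⟨A, hA⟩ := QuotientGroup.mk_surjective (s τ).1
  have h1 : (burau n (sigma i))⁻¹ * A ∈ GamLevel n 2 := by
    refine QuotientGroup.eq.1 ?_
    have := symProj_spec ι (two_dvd_two_pow hk) (s τ)
    have hs : symProj ι (two_dvd_two_pow hk) (s τ) = τ := s.rightHom_splitting τ
    rw [hs, ← hA, GamProj_mk, hτ, ← permutation_sigma, hι] at this
    exact this
  refine mul_self_notMem_GamLevel_four i h1 ?_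
  have h2 : A * A ∈ GamLevel n (2 ^ k) := by
    refine (QuotientGroup.eq_one_iff _).1 ?_
    have e : s τ * s τ = 1 := by rw [← map_mul, Equiv.swap_mul_self, map_one]
    have e' : (s τ).1 * (s τ).1 = 1 := congrArg Subtype.val e
    rw [← hA] at e'
    exact e'
  exact GamLevel_le n (show (4 : ℤ) ∣ 2 ^ k from pow_dvd_pow 2 hk) h2

end BraidCongruence

open BraidCongruence in
theorem theoremA (n k : ℕ) (m ℓ : ℤ) (hn : 2 ≤ n) (hm : Odd m) (hℓ : ℓ = 2 ^ k * m) :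
    -- `Γ_{n-1}` and its congruence subgroups are the symplectic ones:
    -- `Sp_{2g}(ℤ)` if `n - 1 = 2g`, and the stabilizer of `e_1` in `Sp_{2g+2}(ℤ)` if `n - 1 = 2g+1`
    (∀ g : ℕ, n = 2 * g + 1 →
      ∃ φ : Gam n ≃* Matrix.symplecticGroup (Fin g) ℤ,
        ∀ (d : ℤ) (A : Gam n), A ∈ GamLevel n d ↔ CongrOne d (φ A).1) ∧
    (∀ g : ℕ, n = 2 * g + 2 →
      ∃ φ : Gam n ≃* spStab g,
        ∀ (d : ℤ) (A : Gam n), A ∈ GamLevel n d ↔ CongrOne d (φ A).1.1) ∧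
    -- the cases `n = 2, 3`
    (n = 2 ∨ n = 3 →
      ∃ e : Braid n ⧸ BraidLevel n ℓ ≃* Gam n ⧸ GamLevel n ℓ,
        ∀ b : Braid n, e (QuotientGroup.mk b) = QuotientGroup.mk (burau n b)) ∧
    -- the case `n ≥ 4`
    (4 ≤ n →
      (∃ e : Braid n ⧸ BraidLevel n ℓ ≃*
            (Braid n ⧸ BraidLevel n (2 ^ k)) × (Gam n ⧸ GamLevel n m),
        ∀ b : Braid n,
          e (QuotientGroup.mk b) = (QuotientGroup.mk b, QuotientGroup.mk (burau n b))) ∧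
      (k = 0 → Subsingleton (Braid n ⧸ BraidLevel n (2 ^ k))) ∧
      (k = 1 → ∃ e : Braid n ⧸ BraidLevel n (2 ^ k) ≃* Equiv.Perm (Fin n),
        ∀ i : Fin (n - 1), e (QuotientGroup.mk (sigma i)) = Equiv.swap (lo i) (hi i)) ∧
      -- the copy of `S_n` in `Γ_{n-1}/Γ_{n-1}[2]`, and its preimage in `Γ_{n-1}/Γ_{n-1}[2^k]`
      ∃ ι : Equiv.Perm (Fin n) ≃* symImage n,
        (∀ i : Fin (n - 1),
          (ι (Equiv.swap (lo i) (hi i)) : Gam n ⧸ GamLevel n 2) =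
            QuotientGroup.mk (burau n (sigma i))) ∧
        ∀ hk : 2 ≤ k,
          (∃ e : Braid n ⧸ BraidLevel n (2 ^ k) ≃* symPreimage n (two_dvd_two_pow hk),
            ∀ b : Braid n, (e (QuotientGroup.mk b) : Gam n ⧸ GamLevel n (2 ^ k)) =
              QuotientGroup.mk (burau n b)) ∧
          ∃ E : GroupExtension (LevelQuot n (2 ^ k)) (symPreimage n (two_dvd_two_pow hk)) (Equiv.Perm (Fin n)),
            (∀ A : GamLevel n 2, (E.inl (QuotientGroup.mk A) : Gam n ⧸ GamLevel n (2 ^ k)) =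
              QuotientGroup.mk (A : Gam n)) ∧
            (∀ x : symPreimage n (two_dvd_two_pow hk), (ι (E.rightHom x) : Gam n ⧸ GamLevel n 2) =
              GamProj n (two_dvd_two_pow hk) (x : Gam n ⧸ GamLevel n (2 ^ k))) ∧
            IsEmpty E.Splitting) := by
  refine ⟨?_, ?_, ?_, fun _ => ⟨?_, ?_, ?_, ?_⟩⟩
  · rintro g rfl
    exact exists_mulEquiv_symplecticGroup g
  · rintro g rfl
    exact exists_mulEquiv_spStab g
  · intro h
    exact exists_braidQuot_equiv (Or.inl (by omega))
  · subst hℓ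
    exact exists_braidQuot_equiv_prod hm (Int.isCoprime_two_left.2 hm).pow_left
  · rintro rfl
    exact subsingleton_braidQuot_one n
  · rintro rfl
    exact exists_braidQuot_two_equiv n
  · obtain ⟨ι, hι⟩ := exists_perm_equiv_symImage n
    refine ⟨ι, fun i => by rw [← permutation_sigma, hι], fun hk =>
      ⟨exists_braidQuot_equiv_symPreimage hk, levelExtension ι (two_dvd_two_pow hk),
        fun A => rfl, symProj_spec ι _, isEmpty_splitting hn hk ι hι⟩⟩
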